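/- Let $\tau>0$, let $\mathcal C=C([-\tau,0],\mathbb R^n)$ carry the norm $\|\phi\|_\tau=\sup_{s\in[-\tau,0]}\|\phi(s)\|$, and write $x_t(s)=x(t+s)$ for $s\in[-\tau,0]$. Let $f:[0,\infty)\times\mathcal C\times\mathbb R^m\to\mathbb R^n$ and $k:\mathbb R^n\to\mathbb R^m$ satisfy $f(t,0,0)=0$ for all $t\ge 0$ and $k(0)=0$, and assume that for all $t\ge0$, $\phi\in\mathcal C$, $u\in\mathbb R^m$ the equation $\dot x(s)=f(s,x_s,u)$, $x_t=\phi$, has a continuous solution on some interval $[t,t+h)$, $h>0$ ($\dot x$ is the right-hand derivative). For $t_0\ge 0$ and $\varphi\in\mathcal C$ consider the event-triggered closed loop $$\dot x(t)=f(t,x_t,k(x(t_i))),\quad t\in[t_i,t_{i+1}),\qquad x_{t_0}=\varphi,$$ with sampling error $\epsilon(t)=x(t_i)-x(t)$ for $t\in[t_i,t_{i+1})$ and event times $$t_{i+1}=\inf\{t\ge t_i:\ \chi(\|\epsilon(t)\|)=\sigma\,\alpha_1(\|x(t)\|)+\chi(a e^{-b(t-t_0)})\}$$ (with $\epsilon(t)=x(t_i)-x(t)$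 inside the infimum, and $\inf\emptyset=\infty$), where $a>0$, $b>0$ and $0\le\sigma<\mu$. Suppose there are $V_1:[0,\infty)\times\mathbb R^n\to[0,\infty)$ such that $t\mapsto V_1(t,x(t))$ is continuous for every continuous $x$, $V_2:[0,\infty)\times\mathcal C\to[0,\infty)$, locally Lipschitz in its second argument and such that $t\mapsto V_2(t,x_t)$ is continuous for every continuous $x$, functions $\alpha_1,\alpha_2,\alpha_3\in\mathcal K_\infty$, $\chi\in\mathcal K$, and $\mu>0$ such that for all $t\ge 0$, $\phi\in\mathcal C$: (i) $\alpha_1(\|\phi(0)\|)\le V_1(t,\phi(0))\le\alpha_2(\|\phi(0)\|)$ and $0\le V_2(t,\phi)\le\alpha_3(\|\phi\|_\tau)$; (ii) $V(t,\phi)=V_1(t,\phi(0))+V_2(t,\phi)$ satisfies, for every error value $\epsilon\in\mathbb R^n$, $\mathrm D^+V(t,\phi)\le-\mu V(t,\phi)+\chi(\|\epsilon\|)$, where $\mathrm D^+V(t,\phi)=\limsup_{h\to0^+}\frac{V(t+h,x_{t+h})-V(t,\phi)}{h}$ along every local solution of $\dot x(s)=f(s,x_s,u)$, $x_t=\phi$,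 with the held input $u=k(\phi(0)+\epsilon)$. Suppose further that: (iii) $\chi$ and $k$ are locally Lipschitz, and the inverse $\alpha_1^{-1}$ is Lipschitz on every closed bounded subinterval of $(0,\infty)$; (iv) $f$ is Lipschitz in its second and in its third argument on bounded sets: for all $R,S>0$ there is a common Lipschitz constant for all $f(t,\cdot,u)$ and all $f(t,\phi,\cdot)$ on the balls of radius $R$, for all $t\in[0,S]$, $\|\phi\|_\tau\le R$, $\|u\|\le R$. Then the closed loop is globally asymptotically stable: solutions exist for all $t_0\ge0$ and $\varphi\in\mathcal C$, every solution on an interval $[t_0,T)$ can be continued to $[t_0,\infty)$; for all $t_0\ge 0$ and $\varepsilon>0$ there is $\delta>0$ such that $\|\varphi\|_\tau<\delta$ implies $\|x(t)\|<\varepsilon$ for $t\ge t_0$; and $\lim_{t\to\infty}\|x(t)\|=0$ for every $\varphi\in\mathcal C$. Moreover, the closed loop does not exhibit Zeno behavior: no solution, on whatever interval $[t_0,T)$ it is defined, has infinitely many event times in a bounded time interval. If the constants in (iv) can be chosen independently of $S$, then stability and attractivity are uniform in the initial time: $\delta$ can be chosen independent of $t_0$, and for all $r,\varepsilon>0$ there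 is $S>0$ such that $\|\varphi\|_\tau\le r$ implies $\|x(t)\|<\varepsilon$ for all $t\ge t_0+S$, for every $t_0\ge0$. -/

import Mathlib

namespace EventTriggered

open Set Filter Topology

noncomputable section

/-- `ℝⁿ` with the Euclidean norm. -/
abbrev Euc (n : ℕ) := EuclideanSpace ℝ (Fin n)

/-- The space `C([-τ,0], ℝⁿ)`; its norm is the supremum norm. -/
abbrev Hist (τ : ℝ) (n : ℕ) := C(Icc (-τ) (0 : ℝ), Euc n)

/-- The value `φ(0)` of a history `φ`. -/
def Hist.head {τ : ℝ} {n : ℕ} (hτ : 0 < τ) (φ : Hist τ n) : Euc n :=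
  φ ⟨0, by constructor <;> linarith⟩

open Classical in
/-- The history segment `x_t`, that is `x_t(s) = x(t+s)` for `s ∈ [-τ,0]`.
It is only used when `x` is continuous on `[t-τ,t]` (otherwise it is `0` by convention). -/
def histSeg {n : ℕ} (τ : ℝ) (x : ℝ → Euc n) (t : ℝ) : Hist τ n :=
  if h : ContinuousOn x (Icc (t - τ) t) then
    { toFun := fun s => x (t + s.1)
      continuous_toFun :=
        h.comp_continuous (by fun_prop)
          (fun s => ⟨by linarith [s.2.1], by linarith [s.2.2]⟩) }
  else 0

/-- Class `𝒦` (only the values on `[0,∞)` matter). -/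
structure ClassK (α : ℝ → ℝ) : Prop where
  continuousOn : ContinuousOn α (Ici 0)
  strictMonoOn : StrictMonoOn α (Ici 0)
  zero : α 0 = 0

/-- Class `𝒦_∞`. -/
structure ClassKInf (α : ℝ → ℝ) : Prop extends ClassK α where
  tendsto : Tendsto α atTop atTop

/-- Class `𝒱₀` of functions `V : ℝ⁺ × ℝⁿ → ℝ⁺`. -/
structure ClassV0 {n : ℕ} (V : ℝ → Euc n → ℝ) : Prop where
  nonneg : ∀ t, 0 ≤ t → ∀ v, 0 ≤ V t v
  continuousOn : ∀ x : ℝ → Euc n, ContinuousOn x (Ici 0) →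
    ContinuousOn (fun t => V t (x t)) (Ici 0)

/-- Class `𝒱₀*` of functionals `V : ℝ⁺ × C([-τ,0],ℝⁿ) → ℝ⁺`. -/
structure ClassV0Star {τ : ℝ} {n : ℕ} (V : ℝ → Hist τ n → ℝ) : Prop where
  nonneg : ∀ t, 0 ≤ t → ∀ φ, 0 ≤ V t φ
  continuousOn : ∀ x : ℝ → Euc n, ContinuousOn x (Ici (-τ)) →
    ContinuousOn (fun t => V t (histSeg τ x t)) (Ici 0)
  locallyLipschitz : ∀ t, 0 ≤ t → LocallyLipschitz (V t)

/-- Upper right-hand Dini derivative of `g` at `t`, as an extended real number. -/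
def diniUpperRight (g : ℝ → ℝ) (t : ℝ) : EReal :=
  limsup (fun h : ℝ => (((g (t + h) - g t) / h : ℝ) : EReal)) (𝓝[>] 0)

/-- `x` solves `ẋ(s) = f(s, x_s, u)` on `[t, t+h)` with `x_t = φ`, where the input is held at the
constant value `u`. The derivative is the right-hand derivative. -/
structure IsHeldSolution {τ : ℝ} {n m : ℕ} (f : ℝ → Hist τ n → Euc m → Euc n)
    (u : Euc m) (t : ℝ) (φ : Hist τ n) (h : ℝ) (x : ℝ → Euc n) : Prop where
  continuousOn : ContinuousOn x (Ico (t - τ) (t + h))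
  initial : ∀ s : Icc (-τ) (0 : ℝ), x (t + s.1) = φ s
  ode : ∀ s ∈ Ico t (t + h), HasDerivWithinAt x (f s (histSeg τ x s) u) (Ici s) s

/-- For all initial data and every constant input there is a local solution. -/
def LocallySolvable {τ : ℝ} {n m : ℕ} (f : ℝ → Hist τ n → Euc m → Euc n) : Prop :=
  ∀ t, 0 ≤ t → ∀ (φ : Hist τ n) (u : Euc m), ∃ h > 0, ∃ x, IsHeldSolution f u t φ h x

/-- `f` is Lipschitz in its second and in its third argument on bounded sets, with constants that
are uniform for times in `I`. -/
def LipschitzOnBounded {τ : ℝ} {n m : ℕ} (f : ℝ → Hist τ n → Euc m → Euc n) (I : Set ℝ) : Prop :=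
  ∀ R : ℝ, ∃ L : ℝ, ∀ t ∈ I,
    (∀ (φ ψ : Hist τ n) (u : Euc m), ‖φ‖ ≤ R → ‖ψ‖ ≤ R → ‖u‖ ≤ R →
      ‖f t φ u - f t ψ u‖ ≤ L * ‖φ - ψ‖) ∧
    (∀ (φ : Hist τ n) (u v : Euc m), ‖φ‖ ≤ R → ‖u‖ ≤ R → ‖v‖ ≤ R →
      ‖f t φ u - f t φ v‖ ≤ L * ‖u - v‖)

/-- The Lyapunov conditions on the closed loop `ẋ = f(t, x_t, k(x + ε))`. In `decay`, `e` is the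
value of the sampling error at the time `t`, so that the held input is `k(φ(0) + e)`. -/
structure LyapunovConditions {τ : ℝ} (hτ : 0 < τ) {n m : ℕ}
    (f : ℝ → Hist τ n → Euc m → Euc n) (k : Euc n → Euc m)
    (V₁ : ℝ → Euc n → ℝ) (V₂ : ℝ → Hist τ n → ℝ) (α₁ α₂ α₃ χ : ℝ → ℝ) (μ : ℝ) : Prop where
  bounds₁ : ∀ t, 0 ≤ t → ∀ φ : Hist τ n,
    α₁ ‖φ.head hτ‖ ≤ V₁ t (φ.head hτ) ∧ V₁ t (φ.head hτ) ≤ α₂ ‖φ.head hτ‖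
  bounds₂ : ∀ t, 0 ≤ t → ∀ φ : Hist τ n, 0 ≤ V₂ t φ ∧ V₂ t φ ≤ α₃ ‖φ‖
  decay : ∀ t, 0 ≤ t → ∀ (φ : Hist τ n) (e : Euc n), ∀ h > 0, ∀ x : ℝ → Euc n,
    IsHeldSolution f (k (φ.head hτ + e)) t φ h x →
    diniUpperRight (fun s => V₁ s (x s) + V₂ s (histSeg τ x s)) t ≤
      ((-μ * (V₁ t (φ.head hτ) + V₂ t φ) + χ ‖e‖ : ℝ) : EReal)

/-- The triggering condition at time `t`, when the last sample was taken at time `r`. -/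
def Triggered {n : ℕ} (χ α₁ : ℝ → ℝ) (σ a b t₀ : ℝ) (x : ℝ → Euc n) (r t : ℝ) : Prop :=
  χ ‖x r - x t‖ = σ * α₁ ‖x t‖ + χ (a * Real.exp (-b * (t - t₀)))

/-- `x` is a trajectory on `[t₀, T)`, `t₀ < T ≤ ∞`, of the event-triggered closed loop with
`x_{t₀} = φ`, and `te 0 = t₀, te 1, te 2, …` are its event times; `te i = ⊤` means that fewer than
`i` events occur after `t₀` within `[t₀, T)`. Only the values of `x` on `[t₀ - τ, T)` matter. The
sampling intervals cover `[t₀, T)`, so a trajectory ends at the latest where its events accumulate. -/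
structure IsTrajectory {τ : ℝ} {n m : ℕ} (f : ℝ → Hist τ n → Euc m → Euc n) (k : Euc n → Euc m)
    (χ α₁ : ℝ → ℝ) (σ a b : ℝ) (t₀ : ℝ) (φ : Hist τ n) (T : EReal)
    (x : ℝ → Euc n) (te : ℕ → EReal) : Prop where
  lt : (t₀ : EReal) < T
  continuousOn : ContinuousOn x {t : ℝ | t₀ - τ ≤ t ∧ (t : EReal) < T}
  initial : ∀ s : Icc (-τ) (0 : ℝ), x (t₀ + s.1) = φ s
  event_zero : te 0 = t₀
  event_succ : ∀ i, te (i + 1) = sInf ((fun t : ℝ => (t : EReal)) ''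
    {t : ℝ | te i ≤ t ∧ (t : EReal) < T ∧ Triggered χ α₁ σ a b t₀ x (te i).toReal t})
  covers : T ≤ ⨆ i, te i
  ode : ∀ (i : ℕ) (t : ℝ), te i ≤ t → (t : EReal) < te (i + 1) → (t : EReal) < T →
    HasDerivWithinAt x (f t (histSeg τ x t) (k (x (te i).toReal))) (Ici t) t

/-- Global asymptotic stability of the zero solution of the closed loop: trajectories exist for all
initial data and can be continued to `[t₀, ∞)`, the zero solution is stable, and it is
globally attractive. -/
structure GloballyAsymptoticallyStable {τ : ℝ} {n m : ℕ}
    (f : ℝ → Hist τ n → Euc m → Euc n) (k : Euc n → Euc m)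
    (χ α₁ : ℝ → ℝ) (σ a b : ℝ) : Prop where
  exists_global : ∀ t₀, 0 ≤ t₀ → ∀ φ : Hist τ n, ∃ x te,
    IsTrajectory f k χ α₁ σ a b t₀ φ ⊤ x te
  extends_global : ∀ t₀, 0 ≤ t₀ → ∀ (φ : Hist τ n) (T : EReal) (x : ℝ → Euc n) (te : ℕ → EReal),
    IsTrajectory f k χ α₁ σ a b t₀ φ T x te →
    ∃ x' te', IsTrajectory f k χ α₁ σ a b t₀ φ ⊤ x' te' ∧
      ∀ t : ℝ, t₀ - τ ≤ t → (t : EReal) < T → x' t = x t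
  stable : ∀ t₀, 0 ≤ t₀ → ∀ ε > 0, ∃ δ > 0, ∀ φ : Hist τ n, ‖φ‖ < δ →
    ∀ (T : EReal) (x : ℝ → Euc n) (te : ℕ → EReal),
    IsTrajectory f k χ α₁ σ a b t₀ φ T x te →
    ∀ t : ℝ, t₀ ≤ t → (t : EReal) < T → ‖x t‖ < ε
  attractive : ∀ t₀, 0 ≤ t₀ → ∀ (φ : Hist τ n) (x : ℝ → Euc n) (te : ℕ → EReal),
    IsTrajectory f k χ α₁ σ a b t₀ φ ⊤ x te → Tendsto (fun t => ‖x t‖) atTop (𝓝 0)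

/-- Stability and global attractivity, both uniform in the initial time. -/
structure UniformlyStableAttractive {τ : ℝ} {n m : ℕ}
    (f : ℝ → Hist τ n → Euc m → Euc n) (k : Euc n → Euc m)
    (χ α₁ : ℝ → ℝ) (σ a b : ℝ) : Prop where
  stable : ∀ ε > 0, ∃ δ > 0, ∀ t₀, 0 ≤ t₀ → ∀ φ : Hist τ n, ‖φ‖ < δ →
    ∀ (T : EReal) (x : ℝ → Euc n) (te : ℕ → EReal),
    IsTrajectory f k χ α₁ σ a b t₀ φ T x te →
    ∀ t : ℝ, t₀ ≤ t → (t : EReal) < T → ‖x t‖ < ε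
  attractive : ∀ r > 0, ∀ ε > 0, ∃ S > 0, ∀ t₀, 0 ≤ t₀ → ∀ φ : Hist τ n, ‖φ‖ ≤ r →
    ∀ (T : EReal) (x : ℝ → Euc n) (te : ℕ → EReal),
    IsTrajectory f k χ α₁ σ a b t₀ φ T x te →
    ∀ t : ℝ, t₀ + S ≤ t → (t : EReal) < T → ‖x t‖ < ε

/-- No trajectory, on whatever interval `[t₀, T)`, has infinitely many events in finite time. -/
def NoZeno {τ : ℝ} {n m : ℕ}
    (f : ℝ → Hist τ n → Euc m → Euc n) (k : Euc n → Euc m)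
    (χ α₁ : ℝ → ℝ) (σ a b : ℝ) : Prop :=
  ∀ t₀, 0 ≤ t₀ → ∀ (φ : Hist τ n) (T : EReal) (x : ℝ → Euc n) (te : ℕ → EReal),
    IsTrajectory f k χ α₁ σ a b t₀ φ T x te →
    ∀ S : ℝ, {i : ℕ | te i ≤ (S : EReal)}.Finite

end

end EventTriggered

/-!
Between two events the dissipation inequality holds with the sampling error, and the triggering rule
keeps `χ ‖ε‖` below `σ α₁ ‖x‖ + χ (a e^{-b(t-t₀)})` (intermediate value theorem: the gap between the
two sides is positive right after a sample and an event occurs as soon as it vanishes). Hence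
`v(t) = V₁(t, x(t)) + V₂(t, x_t)` is continuous with `D⁺v ≤ -(μ-σ) v + χ (a e^{-b(t-t₀)})` across all
events, and a comparison principle gives, for `t₀ ≤ s ≤ t`,
`v(t) ≤ v(s) e^{-(μ-σ)(t-s)} + χ (a e^{-b(s-t₀)}) / (μ-σ)`
(`LyapunovConditions.lyapunovAlong_le_exp_decay`). This estimate does not depend on where the events
are, and it yields boundedness and attractivity, uniformly in `t₀`.

*No Zeno behaviour, continuation.* A trajectory on a bounded interval is bounded, so by the Lipschitz
property of `f` and `f(t,0,0) = 0` it has bounded speed `C`. At an event the state has moved by at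
least `a e^{-b(T-t₀)}` since the last sample, so the sampling intervals have a minimal length
(`IsTrajectory.exists_event_eq_top`). Bounded speed also gives a limit state at the end of the
interval, from which the held equation can be solved again (`IsTrajectory.exists_continuation`);
Zorn's lemma then provides a continuation to `[t₀, ∞)`. Event times are compared between a trajectory
and its continuations by `IsEventSeq.restrict`: events are causal.

*Stability.* The threshold `χ (a e^{-b(t-t₀)})` does not vanish with the initial data, so the Lyapunov
estimate is not enough at small elapsed times. But `‖ẋ(t)‖ ≤ D sup_{s ≤ t} ‖x(s)‖` whichever sample is
held, so small initial data stay small on a time interval `[t₀, t₀ + T₁]` of prescribed length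
(`exists_small_on_interval`). Taking `T₁` so large that the threshold has become small, the Lyapunov
estimate started at `t₀ + T₁` does the rest. The time `T₁` does not depend on `t₀`, and `D` depends on
`t₀` only through the Lipschitz constants of `f`.
-/

namespace EventTriggered

open Set Filter Topology

/-! ### History segments -/

section History

variable {n : ℕ} {τ : ℝ} {x y : ℝ → Euc n} {t : ℝ}

lemma histSeg_apply (h : ContinuousOn x (Icc (t - τ) t)) (s : Icc (-τ) (0 : ℝ)) :
    histSeg τ x t s = x (t + s.1) := by
  simp [histSeg, h]

lemma histSeg_congr (h : EqOn x y (Icc (t - τ) t)) : histSeg τ x t = histSeg τ y t := by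
  by_cases hx : ContinuousOn x (Icc (t - τ) t)
  · have hy : ContinuousOn y (Icc (t - τ) t) := hx.congr h.symm
    ext1 s
    rw [histSeg_apply hx, histSeg_apply hy]
    exact h ⟨by linarith [s.2.1], by linarith [s.2.2]⟩
  · have hy : ¬ ContinuousOn y (Icc (t - τ) t) := fun hy => hx (hy.congr h)
    simp [histSeg, hx, hy]

lemma head_histSeg (hτ : 0 < τ) (h : ContinuousOn x (Icc (t - τ) t)) :
    (histSeg τ x t).head hτ = x t := by
  simp [Hist.head, histSeg_apply h]

lemma norm_histSeg_le (h : ContinuousOn x (Icc (t - τ) t)) {C : ℝ} (hC : 0 ≤ C)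
    (hx : ∀ s ∈ Icc (t - τ) t, ‖x s‖ ≤ C) : ‖histSeg τ x t‖ ≤ C := by
  rw [ContinuousMap.norm_le _ hC]
  intro s
  rw [histSeg_apply h]
  exact hx _ ⟨by linarith [s.2.1], by linarith [s.2.2]⟩

/-- A function with initial history `φ` is bounded by `‖φ‖` on the initial interval. -/
lemma norm_le_of_initial {φ : Hist τ n} {t₀ : ℝ} (h : ∀ s : Icc (-τ) (0 : ℝ), x (t₀ + s.1) = φ s)
    {s : ℝ} (hs : s ∈ Icc (t₀ - τ) t₀) : ‖x s‖ ≤ ‖φ‖ := by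
  have := h ⟨s - t₀, by linarith [hs.1], by linarith [hs.2]⟩
  simp only [add_sub_cancel] at this
  rw [this]
  exact φ.norm_coe_le_norm _

end History

/-! ### The triggering rule -/

lemma ClassK.nonneg {α : ℝ → ℝ} (hα : ClassK α) {r : ℝ} (hr : 0 ≤ r) : 0 ≤ α r := by
  rw [← hα.zero]
  exact hα.strictMonoOn.monotoneOn self_mem_Ici hr hr

lemma ClassK.pos {α : ℝ → ℝ} (hα : ClassK α) {r : ℝ} (hr : 0 < r) : 0 < α r := by
  rw [← hα.zero]
  exact hα.strictMonoOn self_mem_Ici hr.le hr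

lemma ClassK.continuous_comp {α : ℝ → ℝ} (hα : ClassK α) {X : Type*} [TopologicalSpace X]
    {g : X → ℝ} (hg : Continuous g) (h0 : ∀ p, 0 ≤ g p) : Continuous fun p => α (g p) :=
  hα.continuousOn.comp_continuous hg h0

/-- The gap between the two sides of the triggering condition, for the last sample `v` and the
current state `w` at time `t`: it is positive right after a sample, and an event occurs as soon as
it vanishes. -/
noncomputable def triggerGap {n : ℕ} (χ α₁ : ℝ → ℝ) (σ a b t₀ : ℝ) (v w : Euc n) (t : ℝ) : ℝ :=
  σ * α₁ ‖w‖ + χ (a * Real.exp (-b * (t - t₀))) - χ ‖v - w‖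

section Trigger

variable {n : ℕ} {χ α₁ : ℝ → ℝ} {σ a b t₀ : ℝ} {x : ℝ → Euc n}

lemma triggered_iff {r t : ℝ} :
    Triggered χ α₁ σ a b t₀ x r t ↔ triggerGap χ α₁ σ a b t₀ (x r) (x t) t = 0 := by
  rw [Triggered, triggerGap, sub_eq_zero, eq_comm]

lemma continuous_triggerGap (hχ : ClassK χ) (hα₁ : ClassK α₁) (ha : 0 < a) (v : Euc n) :
    Continuous fun p : Euc n × ℝ => triggerGap χ α₁ σ a b t₀ v p.1 p.2 := by
  have h1 := hα₁.continuous_comp (g := fun p : Euc n × ℝ => ‖p.1‖) (by fun_prop)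
    (fun _ => norm_nonneg _)
  have h2 := hχ.continuous_comp (g := fun p : Euc n × ℝ => ‖v - p.1‖) (by fun_prop)
    (fun _ => norm_nonneg _)
  have h3 := hχ.continuous_comp
    (g := fun p : Euc n × ℝ => a * Real.exp (-b * (p.2 - t₀))) (by fun_prop) (fun _ => by positivity)
  exact ((continuous_const.mul h1).add h3).sub h2

lemma triggerGap_self_pos (hχ : ClassK χ) (hα₁ : ClassK α₁) (hσ : 0 ≤ σ) (ha : 0 < a)
    (v : Euc n) (t : ℝ) : 0 < triggerGap χ α₁ σ a b t₀ v v t := by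
  have h1 := hχ.pos (r := a * Real.exp (-b * (t - t₀))) (by positivity)
  have h2 := mul_nonneg hσ (hα₁.nonneg (norm_nonneg v))
  simp only [triggerGap, sub_self, norm_zero, hχ.zero]
  linarith

/-- No event occurs for a short time after an instant at which the rule is not triggered. -/
lemma exists_not_triggered (hχ : ClassK χ) (hα₁ : ClassK α₁) (ha : 0 < a) {r t : ℝ}
    (hx : ContinuousAt x t) (h : ¬ Triggered χ α₁ σ a b t₀ x r t) :
    ∃ u > t, ∀ s ∈ Ico t u, ¬ Triggered χ α₁ σ a b t₀ x r s := by
  rw [triggered_iff] at h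
  have hc : ContinuousAt (fun s => triggerGap χ α₁ σ a b t₀ (x r) (x s) s) t :=
    ContinuousAt.comp (f := fun s => (x s, s))
      (g := fun p : Euc n × ℝ => triggerGap χ α₁ σ a b t₀ (x r) p.1 p.2)
      (continuous_triggerGap hχ hα₁ ha (x r)).continuousAt (hx.prodMk continuousAt_id)
  obtain ⟨u, hu, hsub⟩ := mem_nhdsGE_iff_exists_Ico_subset.1
    (mem_nhdsWithin_of_mem_nhds (hc.eventually_ne h))
  exact ⟨u, hu, fun s hs => by rw [triggered_iff]; exact hsub hs⟩

/-- As long as the rule is not triggered, the gap stays positive. -/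
lemma triggerGap_pos_of_not_triggered (hχ : ClassK χ) (hα₁ : ClassK α₁) (hσ : 0 ≤ σ) (ha : 0 < a)
    {r t : ℝ} (hrt : r ≤ t) (hx : ContinuousOn x (Icc r t))
    (h : ∀ s ∈ Icc r t, ¬ Triggered χ α₁ σ a b t₀ x r s) :
    0 < triggerGap χ α₁ σ a b t₀ (x r) (x t) t := by
  by_contra! hneg
  have hc : ContinuousOn (fun s => triggerGap χ α₁ σ a b t₀ (x r) (x s) s) (Icc r t) :=
    Continuous.comp_continuousOn (f := fun s => (x s, s))
      (g := fun p : Euc n × ℝ => triggerGap χ α₁ σ a b t₀ (x r) p.1 p.2)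
      (continuous_triggerGap hχ hα₁ ha (x r)) (hx.prodMk continuousOn_id)
  obtain ⟨s, hs, hs0⟩ := intermediate_value_Icc' hrt hc
    ⟨hneg, (triggerGap_self_pos hχ hα₁ hσ ha (x r) r).le⟩
  exact h s hs (triggered_iff.2 hs0)

/-- When an event occurs at `t`, the state has moved by at least `a e^{-b(t-t₀)}` since the last
sample. -/
lemma Triggered.le_norm (hχ : ClassK χ) (hα₁ : ClassK α₁) (hσ : 0 ≤ σ) (ha : 0 < a) {r t : ℝ}
    (h : Triggered χ α₁ σ a b t₀ x r t) : a * Real.exp (-b * (t - t₀)) ≤ ‖x r - x t‖ := by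
  refine (hχ.strictMonoOn.le_iff_le (mem_Ici.2 (by positivity)) (norm_nonneg _)).1 ?_
  rw [h]
  linarith [mul_nonneg hσ (hα₁.nonneg (norm_nonneg (x t)))]

end Trigger

/-! ### Event sequences -/

/-- `te` is the sequence of event times of the function `x` on `[t₀, T)`. -/
structure IsEventSeq {n : ℕ} (χ α₁ : ℝ → ℝ) (σ a b t₀ : ℝ) (T : EReal) (x : ℝ → Euc n)
    (te : ℕ → EReal) : Prop where
  zero : te 0 = t₀
  succ : ∀ i, te (i + 1) = sInf ((fun t : ℝ => (t : EReal)) ''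
    {t : ℝ | te i ≤ t ∧ (t : EReal) < T ∧ Triggered χ α₁ σ a b t₀ x (te i).toReal t})

lemma exists_isEventSeq {n : ℕ} (χ α₁ : ℝ → ℝ) (σ a b t₀ : ℝ) (T : EReal) (x : ℝ → Euc n) :
    ∃ te, IsEventSeq χ α₁ σ a b t₀ T x te :=
  ⟨fun i => Nat.rec (t₀ : EReal) (fun _ p => sInf ((fun t : ℝ => (t : EReal)) ''
    {t : ℝ | p ≤ t ∧ (t : EReal) < T ∧ Triggered χ α₁ σ a b t₀ x p.toReal t})) i, rfl, fun _ => rfl⟩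

section EventSeq

variable {n : ℕ} {χ α₁ : ℝ → ℝ} {σ a b t₀ : ℝ} {T : EReal} {x : ℝ → Euc n} {te : ℕ → EReal}

lemma IsEventSeq.succ_le (h : IsEventSeq χ α₁ σ a b t₀ T x te) {i : ℕ} {t : ℝ} (h1 : te i ≤ t)
    (h2 : (t : EReal) < T) (h3 : Triggered χ α₁ σ a b t₀ x (te i).toReal t) :
    te (i + 1) ≤ t := by
  rw [h.succ]
  exact sInf_le ⟨t, ⟨h1, h2, h3⟩, rfl⟩

lemma IsEventSeq.le_succ_iff (h : IsEventSeq χ α₁ σ a b t₀ T x te) {i : ℕ} {c : EReal} :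
    c ≤ te (i + 1) ↔ ∀ t : ℝ, te i ≤ t → (t : EReal) < T →
      Triggered χ α₁ σ a b t₀ x (te i).toReal t → c ≤ t := by
  rw [h.succ, le_sInf_iff]
  constructor
  · exact fun H t h1 h2 h3 => H _ ⟨t, ⟨h1, h2, h3⟩, rfl⟩
  · rintro H _ ⟨t, ⟨h1, h2, h3⟩, rfl⟩
    exact H t h1 h2 h3

lemma IsEventSeq.monotone (h : IsEventSeq χ α₁ σ a b t₀ T x te) : Monotone te :=
  monotone_nat_of_le_succ fun _ => h.le_succ_iff.2 fun _ h1 _ _ => h1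

lemma IsEventSeq.le (h : IsEventSeq χ α₁ σ a b t₀ T x te) (i : ℕ) : (t₀ : EReal) ≤ te i :=
  h.zero ▸ h.monotone (Nat.zero_le i)

lemma IsEventSeq.eq_top_or_lt (h : IsEventSeq χ α₁ σ a b t₀ T x te) (h0 : (t₀ : EReal) < T)
    (i : ℕ) : te i = ⊤ ∨ te i < T := by
  rcases i with _ | i
  · exact Or.inr (h.zero ▸ h0)
  · by_cases hex : ∃ t : ℝ, te i ≤ t ∧ (t : EReal) < T ∧
        Triggered χ α₁ σ a b t₀ x (te i).toReal t
    · obtain ⟨t, h1, h2, h3⟩ := hex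
      exact Or.inr ((h.succ_le h1 h2 h3).trans_lt h2)
    · refine Or.inl (top_le_iff.1 (h.le_succ_iff.2 fun t h1 h2 h3 => ?_))
      exact absurd ⟨t, h1, h2, h3⟩ hex

lemma IsEventSeq.exists_real (h : IsEventSeq χ α₁ σ a b t₀ T x te) {i : ℕ} (hi : te i ≠ ⊤) :
    ∃ r : ℝ, te i = r ∧ t₀ ≤ r := by
  have hb : te i ≠ ⊥ := ((EReal.bot_lt_coe t₀).trans_le (h.le i)).ne'
  refine ⟨(te i).toReal, (EReal.coe_toReal hi hb).symm, ?_⟩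
  rw [← EReal.coe_le_coe_iff, EReal.coe_toReal hi hb]
  exact h.le i

/-- Events are causal: shortening the time interval to `[t₀, T')` keeps the event times before `T'`
and discards the others. -/
lemma IsEventSeq.restrict {T' : EReal} {y : ℝ → Euc n} {te' : ℕ → EReal}
    (h : IsEventSeq χ α₁ σ a b t₀ T x te) (h' : IsEventSeq χ α₁ σ a b t₀ T' y te')
    (hT : T' ≤ T) (h0 : (t₀ : EReal) < T')
    (heq : ∀ t : ℝ, t₀ ≤ t → (t : EReal) < T' → x t = y t) (i : ℕ) :
    (te i < T' → te' i = te i) ∧ (T' ≤ te i → te' i = ⊤) := by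
  induction i with
  | zero =>
    rw [h.zero, h'.zero]
    exact ⟨fun _ => rfl, fun hle => absurd h0 hle.not_gt⟩
  | succ i ih =>
    rcases lt_or_ge (te i) T' with hi | hi
    · have hi' := ih.1 hi
      obtain ⟨r, hr, hr0⟩ := h.exists_real (hi.trans_le le_top).ne
      have key : ∀ t : ℝ, te i ≤ t → (t : EReal) < T' →
          (Triggered χ α₁ σ a b t₀ x (te i).toReal t ↔
            Triggered χ α₁ σ a b t₀ y (te' i).toReal t) := by
        intro t h1 h2
        rw [hr, EReal.coe_le_coe_iff] at h1
        rw [hi', hr, EReal.toReal_coe, Triggered, Triggered, heq r hr0 (hr ▸ hi),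
          heq t (hr0.trans h1) h2]
      refine ⟨fun hlt => le_antisymm ?_ ?_, fun hle => top_le_iff.1 ?_⟩
      · obtain ⟨_, ⟨s, ⟨hs1, hs2, hs3⟩, rfl⟩, hsT⟩ := sInf_lt_iff.1 (h.succ i ▸ hlt)
        refine h.le_succ_iff.2 fun t h1 h2 h3 => ?_
        rcases lt_or_ge (t : EReal) T' with ht | ht
        · exact h'.succ_le (hi' ▸ h1) ht ((key t h1 ht).1 h3)
        · exact (h'.succ_le (hi' ▸ hs1) hsT ((key s hs1 hsT).1 hs3)).trans (hsT.le.trans ht)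
      · refine h'.le_succ_iff.2 fun t h1 h2 h3 => ?_
        rw [hi'] at h1
        exact h.succ_le h1 (h2.trans_le hT) ((key t h1 h2).2 h3)
      · refine h'.le_succ_iff.2 fun t h1 h2 h3 => ?_
        rw [hi'] at h1
        exact absurd h2 (hle.trans (h.succ_le h1 (h2.trans_le hT) ((key t h1 h2).2 h3))).not_gt
    · have h1 : te' (i + 1) = ⊤ := top_le_iff.1 ((ih.2 hi) ▸ h'.monotone (Nat.le_succ i))
      exact ⟨fun hlt => absurd (hlt.trans_le (hi.trans (h.monotone (Nat.le_succ i)))) (lt_irrefl _),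
        fun _ => h1⟩

end EventSeq

/-! ### Sampling intervals of a trajectory -/

section Trajectory

variable {τ : ℝ} {n m : ℕ} {f : ℝ → Hist τ n → Euc m → Euc n} {k : Euc n → Euc m}
  {χ α₁ : ℝ → ℝ} {σ a b t₀ : ℝ} {φ : Hist τ n} {T : EReal} {x : ℝ → Euc n} {te : ℕ → EReal}

lemma IsTrajectory.isEventSeq (h : IsTrajectory f k χ α₁ σ a b t₀ φ T x te) :
    IsEventSeq χ α₁ σ a b t₀ T x te :=
  ⟨h.event_zero, h.event_succ⟩

lemma IsTrajectory.continuousOn_Icc (h : IsTrajectory f k χ α₁ σ a b t₀ φ T x te) {s t : ℝ}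
    (hs : t₀ - τ ≤ s) (ht : (t : EReal) < T) : ContinuousOn x (Icc s t) :=
  h.continuousOn.mono fun _ hu =>
    ⟨hs.trans hu.1, (EReal.coe_le_coe_iff.2 hu.2).trans_lt ht⟩

/-- Every time in `[t₀, T)` lies in a sampling interval. -/
lemma IsTrajectory.exists_sample (h : IsTrajectory f k χ α₁ σ a b t₀ φ T x te) {t : ℝ}
    (ht0 : t₀ ≤ t) (htT : (t : EReal) < T) :
    ∃ (i : ℕ) (r : ℝ), te i = r ∧ t₀ ≤ r ∧ r ≤ t ∧ (t : EReal) < te (i + 1) := by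
  have hex := lt_iSup_iff.1 (htT.trans_le h.covers)
  classical
  have hne : Nat.find hex ≠ 0 := by
    intro h0
    have := Nat.find_spec hex
    rw [h0, h.event_zero, EReal.coe_lt_coe_iff] at this
    linarith
  obtain ⟨i, hi⟩ := Nat.exists_eq_succ_of_ne_zero hne
  have hmin : te i ≤ t := not_lt.1 (Nat.find_min hex (m := i) (by omega))
  obtain ⟨r, hr, hr0⟩ := h.isEventSeq.exists_real (hmin.trans_lt (EReal.coe_lt_top t)).ne
  refine ⟨i, r, hr, hr0, EReal.coe_le_coe_iff.1 (hr ▸ hmin), ?_⟩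
  have := Nat.find_spec hex
  rwa [hi] at this

/-- At every time `t ∈ [t₀, T)` the trajectory is, for a short while, a solution with an input held
since some sampling time `r ≤ t`, and the triggering gap is positive. -/
lemma IsTrajectory.exists_held (h : IsTrajectory f k χ α₁ σ a b t₀ φ T x te) (hτ : 0 < τ)
    (hχ : ClassK χ) (hα₁ : ClassK α₁) (hσ : 0 ≤ σ) (ha : 0 < a) {t : ℝ}
    (ht0 : t₀ ≤ t) (htT : (t : EReal) < T) :
    ∃ r ∈ Icc t₀ t, 0 < triggerGap χ α₁ σ a b t₀ (x r) (x t) t ∧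
      ∃ l > 0, IsHeldSolution f (k (x r)) t (histSeg τ x t) l x := by
  obtain ⟨i, r, hr, hr0, hrt, hti⟩ := h.exists_sample ht0 htT
  refine ⟨r, ⟨hr0, hrt⟩, ?_, ?_⟩
  · refine triggerGap_pos_of_not_triggered hχ hα₁ hσ ha hrt
      (h.continuousOn_Icc (by linarith) htT) fun s hs htr => ?_
    have hst : (s : EReal) ≤ t := EReal.coe_le_coe_iff.2 hs.2
    have := h.isEventSeq.succ_le (i := i) (t := s) (by rw [hr]; exact_mod_cast hs.1)
      (hst.trans_lt htT) (by rwa [hr, EReal.toReal_coe])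
    exact absurd hti (this.trans hst).not_gt
  · obtain ⟨u, hu1, hu2⟩ := EReal.lt_iff_exists_real_btwn.1 (lt_min hti htT)
    have hu1' : t < u := EReal.coe_lt_coe_iff.1 hu1
    have hb : ∀ s < t + (u - t), (s : EReal) < min (te (i + 1)) T := fun s hs =>
      (EReal.coe_lt_coe_iff.2 (by linarith)).trans hu2
    refine ⟨u - t, by linarith, ?_, ?_, ?_⟩
    · exact h.continuousOn.mono fun s hs =>
        ⟨by linarith [hs.1], (hb s hs.2).trans_le (min_le_right _ _)⟩
    · intro s
      rw [histSeg_apply (h.continuousOn_Icc (by linarith) htT)]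
    · intro s hs
      have := h.ode i s (by rw [hr]; exact_mod_cast hrt.trans hs.1)
        ((hb s hs.2).trans_le (min_le_left _ _)) ((hb s hs.2).trans_le (min_le_right _ _))
      rwa [hr, EReal.toReal_coe] at this

end Trajectory

/-! ### A comparison principle for the Dini derivative -/

lemma le_of_diniUpperRight_le {v v' B B' : ℝ → ℝ} {s t : ℝ} (hv : ContinuousOn v (Icc s t))
    (hd : ∀ u ∈ Ico s t, diniUpperRight v u ≤ ((v' u : ℝ) : EReal)) (h0 : v s ≤ B s)
    (hB : ∀ u, HasDerivAt B (B' u) u) (hlt : ∀ u ∈ Ico s t, v u = B u → v' u < B' u)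
    (hst : s ≤ t) : v t ≤ B t := by
  refine image_le_of_liminf_slope_right_lt_deriv_boundary (f' := v') hv ?_ h0 hB hlt
    (right_mem_Icc.2 hst)
  intro u hu r hr
  have h1 : diniUpperRight v u < (r : EReal) := (hd u hu).trans_lt (EReal.coe_lt_coe_iff.2 hr)
  have h2 := Filter.eventually_lt_of_limsup_lt h1
  have h3 : Tendsto (fun z : ℝ => z - u) (𝓝[>] u) (𝓝[>] 0) := by
    refine tendsto_nhdsWithin_iff.2 ⟨?_, ?_⟩
    · have : Tendsto (fun z : ℝ => z - u) (𝓝 u) (𝓝 (u - u)) :=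
        (continuous_id.sub continuous_const).tendsto u
      rw [sub_self] at this
      exact this.mono_left nhdsWithin_le_nhds
    · filter_upwards [self_mem_nhdsWithin] with z hz
      exact sub_pos.2 (mem_Ioi.1 hz)
  refine Eventually.frequently ?_
  filter_upwards [h3.eventually h2] with z hz
  rw [add_sub_cancel, EReal.coe_lt_coe_iff] at hz
  rwa [slope_def_field]

/-- A function with `D⁺v ≤ -c v + g`, for a nonincreasing `g`, decays exponentially up to the error
`g(s) / c`. -/
lemma le_exp_decay_of_diniUpperRight_le {v g : ℝ → ℝ} {c s t : ℝ} (hc : 0 < c)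
    (hv : ContinuousOn v (Icc s t)) (hg : AntitoneOn g (Icc s t)) (h0 : 0 ≤ g s)
    (hd : ∀ u ∈ Ico s t, diniUpperRight v u ≤ ((-c * v u + g u : ℝ) : EReal)) (hst : s ≤ t) :
    v t ≤ v s * Real.exp (-c * (t - s)) + g s / c := by
  refine le_of_forall_pos_le_add fun ε hε => ?_
  refine le_of_diniUpperRight_le (v' := fun u => -c * v u + g u)
    (B := fun u => v s * Real.exp (-c * (u - s)) + g s / c + ε)
    (B' := fun u => v s * (Real.exp (-c * (u - s)) * (-c * 1))) hv hd ?_ ?_ ?_ hst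
  · simp only [sub_self, mul_zero, Real.exp_zero, mul_one]
    linarith [div_nonneg h0 hc.le]
  · intro u
    exact (((((hasDerivAt_id u).sub_const s).const_mul (-c)).exp.const_mul (v s)).add_const
      (g s / c)).add_const ε
  · intro u hu heq
    have hgu : g u ≤ g s := hg (left_mem_Icc.2 hst) ⟨hu.1, hu.2.le⟩ hu.1
    have hcε : 0 < c * ε := mul_pos hc hε
    have : c * (g s / c) = g s := by field_simp
    simp only [heq]
    linear_combination hgu + hcε - this

/-! ### The Lyapunov functional along a trajectory -/

/-- The value `V₁(t, x(t)) + V₂(t, x_t)` of the Lyapunov functional along `x`. -/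
noncomputable def lyapunovAlong {τ : ℝ} {n : ℕ} (V₁ : ℝ → Euc n → ℝ) (V₂ : ℝ → Hist τ n → ℝ)
    (x : ℝ → Euc n) (t : ℝ) : ℝ :=
  V₁ t (x t) + V₂ t (histSeg τ x t)

lemma continuousOn_lyapunovAlong {τ : ℝ} (hτ : 0 < τ) {n : ℕ} {V₁ : ℝ → Euc n → ℝ}
    {V₂ : ℝ → Hist τ n → ℝ} (hV₁ : ClassV0 V₁) (hV₂ : ClassV0Star V₂) {x : ℝ → Euc n} {s t : ℝ}
    (hs : 0 ≤ s) (hst : s ≤ t) (hx : ContinuousOn x (Icc (s - τ) t)) :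
    ContinuousOn (lyapunovAlong V₁ V₂ x) (Icc s t) := by
  -- The classes of `V₁` and `V₂` speak of functions that are continuous on a half-line.
  have hle : s - τ ≤ t := by linarith
  set y : ℝ → Euc n := IccExtend hle ((Icc (s - τ) t).domRestrict x) with hy
  have hyc : Continuous y := hx.domRestrict.Icc_extend'
  have hyx : EqOn x y (Icc (s - τ) t) := fun u hu => by
    rw [hy, IccExtend_of_mem hle _ hu, domRestrict_apply]
  have hsub : Icc s t ⊆ Ici 0 := fun u hu => hs.trans hu.1
  have h1 := (hV₁.continuousOn y hyc.continuousOn).mono hsub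
  have h2 := (hV₂.continuousOn y hyc.continuousOn).mono hsub
  refine (h1.add h2).congr fun u hu => ?_
  have hyu := hyx ⟨by linarith [hu.1], hu.2⟩
  have hseg : histSeg τ x u = histSeg τ y u :=
    histSeg_congr (hyx.mono (Icc_subset_Icc (by linarith [hu.1]) hu.2))
  simp only [lyapunovAlong, hyu, hseg, Pi.add_apply]

section Lyapunov

variable {τ : ℝ} {n m : ℕ} {f : ℝ → Hist τ n → Euc m → Euc n} {k : Euc n → Euc m}
  {V₁ : ℝ → Euc n → ℝ} {V₂ : ℝ → Hist τ n → ℝ} {α₁ α₂ α₃ χ : ℝ → ℝ} {μ : ℝ}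
  {σ a b t₀ : ℝ} {φ : Hist τ n} {T : EReal} {x : ℝ → Euc n} {te : ℕ → EReal}

lemma LyapunovConditions.le_lyapunovAlong {hτ : 0 < τ}
    (hV : LyapunovConditions hτ f k V₁ V₂ α₁ α₂ α₃ χ μ) {t : ℝ} (ht : 0 ≤ t)
    (hx : ContinuousOn x (Icc (t - τ) t)) : α₁ ‖x t‖ ≤ lyapunovAlong V₁ V₂ x t := by
  have h1 := (hV.bounds₁ t ht (histSeg τ x t)).1
  have h2 := (hV.bounds₂ t ht (histSeg τ x t)).1
  rw [head_histSeg hτ hx] at h1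
  exact h1.trans (le_add_of_nonneg_right h2)

lemma LyapunovConditions.lyapunovAlong_le {hτ : 0 < τ}
    (hV : LyapunovConditions hτ f k V₁ V₂ α₁ α₂ α₃ χ μ) (hα₂ : ClassK α₂) (hα₃ : ClassK α₃)
    {t r : ℝ} (ht : 0 ≤ t) (hx : ContinuousOn x (Icc (t - τ) t)) (hr : 0 ≤ r)
    (hxr : ∀ s ∈ Icc (t - τ) t, ‖x s‖ ≤ r) :
    lyapunovAlong V₁ V₂ x t ≤ α₂ r + α₃ r := by
  have h1 := (hV.bounds₁ t ht (histSeg τ x t)).2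
  have h2 := (hV.bounds₂ t ht (histSeg τ x t)).2
  rw [head_histSeg hτ hx] at h1
  have h3 := hα₂.strictMonoOn.monotoneOn (norm_nonneg _) hr (hxr t ⟨by linarith, le_rfl⟩)
  have h4 := hα₃.strictMonoOn.monotoneOn (norm_nonneg _) hr (norm_histSeg_le hx hr hxr)
  exact add_le_add (h1.trans h3) (h2.trans h4)

/-- The triggering rule turns the dissipation inequality into `D⁺V ≤ -(μ-σ)V + χ(a e^{-b(t-t₀)})`. -/
lemma LyapunovConditions.diniUpperRight_le {hτ : 0 < τ}
    (hV : LyapunovConditions hτ f k V₁ V₂ α₁ α₂ α₃ χ μ) (hχ : ClassK χ) (hα₁ : ClassK α₁)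
    (hσ : 0 ≤ σ) (ha : 0 < a) (ht₀ : 0 ≤ t₀) (h : IsTrajectory f k χ α₁ σ a b t₀ φ T x te)
    {t : ℝ} (ht0 : t₀ ≤ t) (htT : (t : EReal) < T) :
    diniUpperRight (lyapunovAlong V₁ V₂ x) t ≤
      ((-(μ - σ) * lyapunovAlong V₁ V₂ x t + χ (a * Real.exp (-b * (t - t₀))) : ℝ) : EReal) := by
  obtain ⟨r, -, hgap, l, hl, hsol⟩ := h.exists_held hτ hχ hα₁ hσ ha ht0 htT
  have hc : ContinuousOn x (Icc (t - τ) t) := h.continuousOn_Icc (by linarith) htT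
  have hhead := head_histSeg hτ hc
  have hd := hV.decay t (ht₀.trans ht0) (histSeg τ x t) (x r - x t) l hl x
    (by rwa [hhead, add_sub_cancel])
  rw [hhead] at hd
  refine hd.trans (EReal.coe_le_coe_iff.2 ?_)
  have h1 := mul_le_mul_of_nonneg_left (hV.le_lyapunovAlong (ht₀.trans ht0) hc) hσ
  rw [triggerGap] at hgap
  simp only [lyapunovAlong] at h1 ⊢
  linarith

lemma antitone_threshold (hχ : ClassK χ) (ha : 0 < a) (hb : 0 < b) :
    Antitone fun t => χ (a * Real.exp (-b * (t - t₀))) := by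
  intro s t hst
  refine hχ.strictMonoOn.monotoneOn (mem_Ici.2 (by positivity)) (mem_Ici.2 (by positivity)) ?_
  refine mul_le_mul_of_nonneg_left (Real.exp_le_exp.2 ?_) ha.le
  have := mul_le_mul_of_nonneg_left hst hb.le
  linarith

lemma LyapunovConditions.lyapunovAlong_le_exp_decay {hτ : 0 < τ}
    (hV : LyapunovConditions hτ f k V₁ V₂ α₁ α₂ α₃ χ μ) (hV₁ : ClassV0 V₁) (hV₂ : ClassV0Star V₂)
    (hχ : ClassK χ) (hα₁ : ClassK α₁) (hσ : 0 ≤ σ) (hσμ : σ < μ) (ha : 0 < a) (hb : 0 < b)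
    (ht₀ : 0 ≤ t₀) (h : IsTrajectory f k χ α₁ σ a b t₀ φ T x te)
    {s t : ℝ} (hs : t₀ ≤ s) (hst : s ≤ t) (htT : (t : EReal) < T) :
    lyapunovAlong V₁ V₂ x t ≤ lyapunovAlong V₁ V₂ x s * Real.exp (-(μ - σ) * (t - s)) +
      χ (a * Real.exp (-b * (s - t₀))) / (μ - σ) := by
  refine le_exp_decay_of_diniUpperRight_le (g := fun u => χ (a * Real.exp (-b * (u - t₀))))
    (sub_pos.2 hσμ) (continuousOn_lyapunovAlong hτ hV₁ hV₂ (ht₀.trans hs) hst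
      (h.continuousOn_Icc (by linarith) htT)) ((antitone_threshold hχ ha hb).antitoneOn _)
    (hχ.nonneg (by positivity)) (fun u hu => ?_) hst
  exact hV.diniUpperRight_le hχ hα₁ hσ ha ht₀ h (hs.trans hu.1)
    ((EReal.coe_lt_coe_iff.2 hu.2).trans htT)

/-! ### Boundedness and absence of Zeno behaviour -/

lemma IsTrajectory.exists_norm_le {hτ : 0 < τ} (h : IsTrajectory f k χ α₁ σ a b t₀ φ T x te)
    (hV : LyapunovConditions hτ f k V₁ V₂ α₁ α₂ α₃ χ μ) (hV₁ : ClassV0 V₁) (hV₂ : ClassV0Star V₂)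
    (hχ : ClassK χ) (hα₁ : ClassKInf α₁) (hσ : 0 ≤ σ) (hσμ : σ < μ) (ha : 0 < a) (hb : 0 < b)
    (ht₀ : 0 ≤ t₀) : ∃ R, 0 ≤ R ∧ ∀ t : ℝ, t₀ - τ ≤ t → (t : EReal) < T → ‖x t‖ ≤ R := by
  set M := lyapunovAlong V₁ V₂ x t₀ + χ (a * Real.exp (-b * (t₀ - t₀))) / (μ - σ) with hM
  obtain ⟨R, hR, hR0⟩ :=
    ((hα₁.tendsto.eventually_gt_atTop M).and (eventually_ge_atTop 0)).exists
  refine ⟨max R ‖φ‖, hR0.trans (le_max_left _ _), fun t ht htT => ?_⟩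
  rcases le_total t t₀ with h0 | h0
  · exact (norm_le_of_initial h.initial ⟨ht, h0⟩).trans (le_max_right _ _)
  · refine le_trans ?_ (le_max_left _ _)
    have hc : ContinuousOn x (Icc (t - τ) t) := h.continuousOn_Icc (by linarith) htT
    have h1 := hV.le_lyapunovAlong (ht₀.trans h0) hc
    have h2 := hV.lyapunovAlong_le_exp_decay hV₁ hV₂ hχ hα₁.toClassK hσ hσμ ha hb ht₀ h le_rfl h0
      htT
    have h3 : 0 ≤ lyapunovAlong V₁ V₂ x t₀ :=
      (hα₁.nonneg (norm_nonneg _)).trans (hV.le_lyapunovAlong ht₀ (h.continuousOn_Icc le_rfl h.lt))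
    have h4 : Real.exp (-(μ - σ) * (t - t₀)) ≤ 1 := by
      rw [Real.exp_le_one_iff]
      nlinarith
    have h5 := mul_le_mul_of_nonneg_left h4 h3
    refine (hα₁.strictMonoOn.le_iff_le (norm_nonneg _) hR0).1 ?_
    linarith

/-- Since `f(t,0,0) = 0`, the local Lipschitz constant controls the size of `f`. -/
lemma norm_le_of_lipschitz {t R L : ℝ} (hf0 : f t 0 0 = 0) (hR : 0 ≤ R)
    (hL : (∀ (φ ψ : Hist τ n) (u : Euc m), ‖φ‖ ≤ R → ‖ψ‖ ≤ R → ‖u‖ ≤ R →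
        ‖f t φ u - f t ψ u‖ ≤ L * ‖φ - ψ‖) ∧
      (∀ (φ : Hist τ n) (u v : Euc m), ‖φ‖ ≤ R → ‖u‖ ≤ R → ‖v‖ ≤ R →
        ‖f t φ u - f t φ v‖ ≤ L * ‖u - v‖))
    {ψ : Hist τ n} {u : Euc m} (hψ : ‖ψ‖ ≤ R) (hu : ‖u‖ ≤ R) :
    ‖f t ψ u‖ ≤ L * (‖ψ‖ + ‖u‖) := by
  have h1 := hL.1 ψ 0 u hψ (by simpa) hu
  have h2 := hL.2 0 u 0 (by simpa) hu (by simpa)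
  rw [sub_zero] at h1 h2
  rw [hf0, sub_zero] at h2
  calc ‖f t ψ u‖ = ‖(f t ψ u - f t 0 u) + f t 0 u‖ := by rw [sub_add_cancel]
    _ ≤ L * ‖ψ‖ + L * ‖u‖ := (norm_add_le _ _).trans (add_le_add h1 h2)
    _ = L * (‖ψ‖ + ‖u‖) := by ring

/-- A bounded trajectory on a bounded time interval has bounded speed. -/
lemma IsTrajectory.exists_lipschitz {T : ℝ} (h : IsTrajectory f k χ α₁ σ a b t₀ φ T x te)
    (hτ : 0 < τ) (hf0 : ∀ t, 0 ≤ t → f t 0 0 = 0) (hk : Continuous k)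
    (hf : LipschitzOnBounded f (Icc 0 T)) (hχ : ClassK χ) (hα₁ : ClassK α₁) (hσ : 0 ≤ σ)
    (ha : 0 < a) (ht₀ : 0 ≤ t₀) {R : ℝ} (hR : 0 ≤ R)
    (hxR : ∀ t : ℝ, t₀ - τ ≤ t → (t : EReal) < T → ‖x t‖ ≤ R) :
    ∃ C > 0, ∀ s t, t₀ ≤ s → s ≤ t → t < T → ‖x t - x s‖ ≤ C * (t - s) := by
  obtain ⟨K, hK⟩ := (isCompact_closedBall (0 : Euc n) R).exists_bound_of_continuousOn
    hk.continuousOn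
  set R' := max R K with hR'
  have hR'0 : 0 ≤ R' := hR.trans (le_max_left _ _)
  obtain ⟨L, hL⟩ := hf R'
  refine ⟨|L| * (R' + R') + 1, by positivity, fun s t hs hst htT => ?_⟩
  choose! r hr hgap l hl hsol using fun (u : ℝ) (h1 : t₀ ≤ u ∧ (u : EReal) < T) =>
    h.exists_held hτ hχ hα₁ hσ ha h1.1 h1.2
  have htT' : (t : EReal) < T := EReal.coe_lt_coe_iff.2 htT
  refine norm_image_sub_le_of_norm_deriv_right_le_segment
    (f' := fun u => f u (histSeg τ x u) (k (x (r u)))) (h.continuousOn_Icc (by linarith) htT')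
    (fun u hu => ?_) (fun u hu => ?_) t (right_mem_Icc.2 hst)
  all_goals
    have huT : (u : EReal) < T := (EReal.coe_lt_coe_iff.2 hu.2).trans htT'
    have hu' : t₀ ≤ u ∧ (u : EReal) < T := ⟨hs.trans hu.1, huT⟩
  · exact (hsol u hu').ode u ⟨le_rfl, by linarith [hl u hu']⟩
  · have h1 : ‖histSeg τ x u‖ ≤ R' :=
      norm_histSeg_le (h.continuousOn_Icc (by linarith [hu.1]) huT) hR'0 fun q hq =>
        (hxR q (by linarith [hq.1, hu.1]) ((EReal.coe_le_coe_iff.2 hq.2).trans_lt huT)).trans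
          (le_max_left _ _)
    have h2 : ‖k (x (r u))‖ ≤ R' := by
      refine (hK _ (mem_closedBall_zero_iff.2 (hxR _ (by linarith [(hr u hu').1]) ?_))).trans
        (le_max_right _ _)
      exact (EReal.coe_le_coe_iff.2 (hr u hu').2).trans_lt huT
    have h0u : 0 ≤ u := ht₀.trans hu'.1
    have h3 := norm_le_of_lipschitz (hf0 u h0u) hR'0 (hL u ⟨h0u, hu.2.le.trans htT.le⟩) h1 h2
    have h4 : L * (‖histSeg τ x u‖ + ‖k (x (r u))‖) ≤ |L| * (R' + R') :=
      mul_le_mul (le_abs_self L) (add_le_add h1 h2) (by positivity) (abs_nonneg L)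
    linarith

/-- If the speed is bounded, then the sampling intervals in bounded time have a minimal length, so
that only finitely many events occur. -/
lemma IsTrajectory.exists_event_eq_top {T : ℝ} (h : IsTrajectory f k χ α₁ σ a b t₀ φ T x te)
    (hχ : ClassK χ) (hα₁ : ClassK α₁) (hσ : 0 ≤ σ) (ha : 0 < a) (hb : 0 < b) {C : ℝ} (hC : 0 < C)
    (hLip : ∀ s t, t₀ ≤ s → s ≤ t → t < T → ‖x t - x s‖ ≤ C * (t - s)) :
    ∃ N, te N = ⊤ := by
  by_contra! hne
  have hev := h.isEventSeq
  choose r hr hr0 using fun i => hev.exists_real (hne i)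
  set d := a * Real.exp (-b * (T - t₀)) / C with hd
  have hd0 : 0 < d := by positivity
  have hstep : ∀ i, r i + d ≤ r (i + 1) := by
    intro i
    rw [← EReal.coe_le_coe_iff, ← hr (i + 1)]
    refine hev.le_succ_iff.2 fun t h1 h2 h3 => ?_
    rw [hr, EReal.coe_le_coe_iff] at h1
    rw [hr, EReal.toReal_coe] at h3
    rw [EReal.coe_lt_coe_iff] at h2
    have h4 := h3.le_norm hχ hα₁ hσ ha
    rw [norm_sub_rev] at h4
    have h5 := hLip (r i) t (hr0 i) h1 h2
    have h6 : a * Real.exp (-b * (T - t₀)) ≤ a * Real.exp (-b * (t - t₀)) := by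
      refine mul_le_mul_of_nonneg_left (Real.exp_le_exp.2 ?_) ha.le
      have := mul_le_mul_of_nonneg_left h2.le hb.le
      linarith
    have h7 : d ≤ t - r i := by
      rw [hd, div_le_iff₀ hC]
      linarith
    rw [EReal.coe_le_coe_iff]
    linarith
  have hlow : ∀ i : ℕ, t₀ + i * d ≤ r i := by
    intro i
    induction i with
    | zero => simpa using hr0 0
    | succ i ih =>
      push_cast
      linarith [hstep i]
  obtain ⟨N, hN⟩ := exists_nat_gt ((T - t₀) / d)
  rw [div_lt_iff₀ hd0] at hN
  have h1 : r N < T := by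
    have := (hev.eq_top_or_lt h.lt N).resolve_left (hne N)
    rwa [hr, EReal.coe_lt_coe_iff] at this
  linarith [hlow N]

end Lyapunov

/-! ### Continuation of trajectories -/

section Continuation

variable {τ : ℝ} {n m : ℕ} {f : ℝ → Hist τ n → Euc m → Euc n} {k : Euc n → Euc m}
  {χ α₁ : ℝ → ℝ} {σ a b t₀ : ℝ} {φ : Hist τ n}

/-- For a short time the held solution from the initial sample is a trajectory without events. -/
lemma exists_local_trajectory (hτ : 0 < τ) (hsol : LocallySolvable f) (hχ : ClassK χ)
    (hα₁ : ClassK α₁) (hσ : 0 ≤ σ) (ha : 0 < a) (ht₀ : 0 ≤ t₀) (φ : Hist τ n) :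
    ∃ (T : EReal) (x : ℝ → Euc n) (te : ℕ → EReal),
      IsTrajectory f k χ α₁ σ a b t₀ φ T x te := by
  obtain ⟨l, hl, x, hx⟩ := hsol t₀ ht₀ φ (k (φ.head hτ))
  have hx0 : x t₀ = φ.head hτ := by
    have := hx.initial ⟨0, by constructor <;> linarith⟩
    rwa [add_zero] at this
  have hnt : ¬ Triggered χ α₁ σ a b t₀ x t₀ t₀ := by
    rw [triggered_iff]
    exact (triggerGap_self_pos hχ hα₁ hσ ha (x t₀) t₀).ne'
  have hxc : ContinuousAt x t₀ :=
    hx.continuousOn.continuousAt (Ico_mem_nhds (by linarith) (by linarith))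
  obtain ⟨v, hv, hnv⟩ := exists_not_triggered hχ hα₁ ha hxc hnt
  obtain ⟨te, hte⟩ := exists_isEventSeq χ α₁ σ a b t₀ ((min v (t₀ + l) : ℝ) : EReal) x
  have h1 : te (0 + 1) = ⊤ := by
    refine top_le_iff.1 (hte.le_succ_iff.2 fun t h1 h2 h3 => ?_)
    rw [hte.zero, EReal.toReal_coe] at h3
    rw [hte.zero, EReal.coe_le_coe_iff] at h1
    exact absurd h3 (hnv t ⟨h1, (EReal.coe_lt_coe_iff.1 h2).trans_le (min_le_left _ _)⟩)
  refine ⟨((min v (t₀ + l) : ℝ) : EReal), x, te, ?_, ?_, hx.initial, hte.zero, hte.succ, ?_, ?_⟩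
  · exact EReal.coe_lt_coe_iff.2 (lt_min hv (by linarith))
  · exact hx.continuousOn.mono fun t ht =>
      ⟨ht.1, (EReal.coe_lt_coe_iff.1 ht.2).trans_le (min_le_right _ _)⟩
  · exact le_top.trans (h1 ▸ le_iSup te (0 + 1))
  · intro i t h2 h3 h4
    rcases i with _ | i
    · rw [hte.zero, EReal.toReal_coe, hx0]
      rw [hte.zero, EReal.coe_le_coe_iff] at h2
      exact hx.ode t ⟨h2, (EReal.coe_lt_coe_iff.1 h4).trans_le (min_le_right _ _)⟩
    · have : te (i + 1) = ⊤ := top_le_iff.1 (h1 ▸ hte.monotone (by omega))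
      rw [this] at h2
      exact absurd h2 (EReal.coe_lt_top t).not_ge

/-- A trajectory on a bounded interval with bounded speed and finitely many events can be continued:
it has a limit state at the end of the interval, from which the held equation is solved with the
last sample, or with the limit state itself if an event occurs there. -/
lemma IsTrajectory.exists_continuation {T : ℝ} {x : ℝ → Euc n} {te : ℕ → EReal}
    (h : IsTrajectory f k χ α₁ σ a b t₀ φ T x te) (hτ : 0 < τ) (hsol : LocallySolvable f)
    (hχ : ClassK χ) (hα₁ : ClassK α₁) (hσ : 0 ≤ σ) (ha : 0 < a) (ht₀ : 0 ≤ t₀) {C : ℝ} (hC : 0 < C)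
    (hLip : ∀ s t, t₀ ≤ s → s ≤ t → t < T → ‖x t - x s‖ ≤ C * (t - s)) (hN : ∃ N, te N = ⊤) :
    ∃ T' > T, ∃ (x' : ℝ → Euc n) (te' : ℕ → EReal),
      IsTrajectory f k χ α₁ σ a b t₀ φ (T' : ℝ) x' te' ∧ ∀ t, t < T → x' t = x t := by
  have ht₀T : t₀ < T := EReal.coe_lt_coe_iff.1 h.lt
  have hev := h.isEventSeq
  -- The last event before `T`.
  obtain ⟨j, r, hjr, hr0, hrT, hj1⟩ :
      ∃ (j : ℕ) (r : ℝ), te j = r ∧ t₀ ≤ r ∧ r < T ∧ te (j + 1) = ⊤ := by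
    classical
    have hne : Nat.find hN ≠ 0 := by
      intro h0
      have := Nat.find_spec hN
      rw [h0, h.event_zero] at this
      exact EReal.coe_ne_top _ this
    obtain ⟨j, hj⟩ := Nat.exists_eq_succ_of_ne_zero hne
    have hjt : te j ≠ ⊤ := Nat.find_min hN (m := j) (by omega)
    obtain ⟨r, hr, hr0⟩ := hev.exists_real hjt
    refine ⟨j, r, hr, hr0, ?_, ?_⟩
    · have := (hev.eq_top_or_lt h.lt j).resolve_left hjt
      rwa [hr, EReal.coe_lt_coe_iff] at this
    · have := Nat.find_spec hN
      rwa [hj] at this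
  -- `z` completes `x` by its limit at `T`.
  obtain ⟨g, hgc, hgx⟩ : ∃ g : ℝ → Euc n, Continuous g ∧ EqOn x g (Ico t₀ T) := by
    have hL : LipschitzOnWith C.toNNReal x (Ico t₀ T) := by
      refine LipschitzOnWith.of_dist_le_mul fun s hs t ht => ?_
      rw [Real.coe_toNNReal _ hC.le, dist_eq_norm, Real.dist_eq]
      rcases le_total s t with hst | hst
      · rw [norm_sub_rev, abs_sub_comm, abs_of_nonneg (sub_nonneg.2 hst)]
        exact hLip s t hs.1 hst ht.2
      · rw [abs_of_nonneg (sub_nonneg.2 hst)]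
        exact hLip t s ht.1 hst hs.2
    obtain ⟨g, hg, hgx⟩ := hL.extend_finite_dimension
    exact ⟨g, hg.continuous, hgx⟩
  set z : ℝ → Euc n := fun t => if t < T then x t else g t with hz
  have hzx : ∀ t < T, z t = x t := fun t ht => by simp [hz, ht]
  have hzg : ∀ t, t₀ ≤ t → z t = g t := fun t ht => by
    by_cases htT : t < T
    · rw [hzx t htT, hgx ⟨ht, htT⟩]
    · simp [hz, htT]
  have hzc : ContinuousOn z (Icc (T - τ) T) := by
    intro t ht
    refine ContinuousAt.continuousWithinAt ?_
    rcases ht.2.lt_or_eq with htT | rfl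
    · have hxt : ContinuousAt x t := by
        obtain ⟨u, hu1, hu2⟩ := exists_between htT
        exact (h.continuousOn_Icc le_rfl (EReal.coe_lt_coe_iff.2 hu2)).continuousAt
          (Icc_mem_nhds (by linarith [ht.1]) hu1)
      exact hxt.congr (by filter_upwards [Iio_mem_nhds htT] with s hs using (hzx s hs).symm)
    · exact hgc.continuousAt.congr
        (by filter_upwards [Ioi_mem_nhds ht₀T] with s hs using (hzg s (le_of_lt hs)).symm)
  -- The sample `q` that is held right after `T`.
  obtain ⟨q, hqT, hqn, hq⟩ : ∃ q ≤ T, ¬ Triggered χ α₁ σ a b t₀ z q T ∧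
      (q = T ∧ Triggered χ α₁ σ a b t₀ z r T ∨ q = r) := by
    by_cases htr : Triggered χ α₁ σ a b t₀ z r T
    · refine ⟨T, le_rfl, ?_, Or.inl ⟨rfl, htr⟩⟩
      rw [triggered_iff]
      exact (triggerGap_self_pos hχ hα₁ hσ ha (z T) T).ne'
    · exact ⟨r, hrT.le, htr, Or.inr rfl⟩
  obtain ⟨l, hl, y, hy⟩ := hsol T (ht₀.trans ht₀T.le) (histSeg τ z T) (k (z q))
  have hyz : ∀ t ∈ Icc (T - τ) T, y t = z t := by
    intro t ht
    have := hy.initial ⟨t - T, by linarith [ht.1], by linarith [ht.2]⟩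
    rwa [histSeg_apply hzc, add_sub_cancel] at this
  set w : ℝ → Euc n := fun t => if t < T then x t else y t with hw
  have hwx : ∀ t < T, w t = x t := fun t ht => by simp [hw, ht]
  have hwy : ∀ t, T - τ ≤ t → w t = y t := fun t ht => by
    by_cases htT : t < T
    · rw [hwx t htT, hyz t ⟨ht, htT.le⟩, hzx t htT]
    · simp [hw, htT]
  have hwz : ∀ t ≤ T, w t = z t := fun t ht => by
    rcases ht.lt_or_eq with htT | rfl
    · rw [hwx t htT, hzx t htT]
    · rw [hwy t (by linarith), hyz t ⟨by linarith, le_rfl⟩]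
  have hwc_right : ∀ t, T ≤ t → t < T + l → ContinuousAt w t := by
    intro t h1 h2
    have : ContinuousAt y t := hy.continuousOn.continuousAt (Ico_mem_nhds (by linarith) h2)
    refine this.congr ?_
    filter_upwards [Ioi_mem_nhds (show T - τ < t by linarith)] with s hs using (hwy s (le_of_lt hs)).symm
  have hwc : ContinuousOn w (Ico (t₀ - τ) (T + l)) := by
    intro t ht
    rcases lt_or_ge t T with htT | htT
    · have h1 : ContinuousWithinAt x (Ico (t₀ - τ) (T + l)) t := by
        refine (h.continuousOn t ⟨ht.1, EReal.coe_lt_coe_iff.2 htT⟩).mono_of_mem_nhdsWithin ?_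
        filter_upwards [self_mem_nhdsWithin, mem_nhdsWithin_of_mem_nhds (Iio_mem_nhds htT)]
          with s hs hsT using ⟨hs.1, EReal.coe_lt_coe_iff.2 hsT⟩
      refine h1.congr_of_eventuallyEq ?_ (hwx t htT)
      filter_upwards [mem_nhdsWithin_of_mem_nhds (Iio_mem_nhds htT)] with s hs using hwx s hs
    · exact (hwc_right t htT ht.2).continuousWithinAt
  have hqw : ¬ Triggered χ α₁ σ a b t₀ w q T := by
    rwa [Triggered, hwz q hqT, hwz T le_rfl]
  obtain ⟨v, hv, hnv⟩ := exists_not_triggered hχ hα₁ ha (hwc_right T le_rfl (by linarith)) hqw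
  set T' : ℝ := min v (T + l) with hT'
  have hTT' : T < T' := lt_min hv (by linarith)
  obtain ⟨te', hte'⟩ := exists_isEventSeq χ α₁ σ a b t₀ (T' : EReal) w
  have hres := hte'.restrict hev (EReal.coe_le_coe_iff.2 hTT'.le) h.lt
    fun t _ ht => hwx t (EReal.coe_lt_coe_iff.1 ht)
  have hj' : te' j = r := by
    have hlt : te' j < T := by
      by_contra! hge
      exact EReal.coe_ne_top r (hjr ▸ (hres j).2 hge)
    rw [← (hres j).1 hlt, hjr]
  have hj1' : (T : EReal) ≤ te' (j + 1) := by
    by_contra! hlt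
    rw [← (hres (j + 1)).1 hlt, hj1] at hlt
    exact not_top_lt hlt
  -- After `T`, the sample taken at `q` is held until `T'`.
  obtain ⟨i₀, hi₀, hi₁⟩ : ∃ i, te' i = q ∧ te' (i + 1) = ⊤ := by
    rcases hq with ⟨rfl, htr⟩ | rfl
    · have hq1 : te' (j + 1) = q := by
        refine le_antisymm (hte'.succ_le (by rw [hj']; exact_mod_cast hrT.le)
          (EReal.coe_lt_coe_iff.2 hTT') ?_) hj1'
        rwa [hj', EReal.toReal_coe, Triggered, hwz r hrT.le, hwz q le_rfl]
      refine ⟨j + 1, hq1, top_le_iff.1 (hte'.le_succ_iff.2 fun t h1 h2 h3 => ?_)⟩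
      rw [hq1, EReal.toReal_coe] at h3
      rw [hq1, EReal.coe_le_coe_iff] at h1
      exact absurd h3 (hnv t ⟨h1, (EReal.coe_lt_coe_iff.1 h2).trans_le (min_le_left _ _)⟩)
    · refine ⟨j, hj', top_le_iff.1 (hte'.le_succ_iff.2 fun t h1 h2 h3 => ?_)⟩
      have hTt : T ≤ t := EReal.coe_le_coe_iff.1 (hj1'.trans (hte'.succ_le h1 h2 h3))
      rw [hj', EReal.toReal_coe] at h3
      exact absurd h3 (hnv t ⟨hTt, (EReal.coe_lt_coe_iff.1 h2).trans_le (min_le_left _ _)⟩)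
  refine ⟨T', hTT', w, te', ⟨?_, ?_, ?_, hte'.zero, hte'.succ, ?_, ?_⟩, hwx⟩
  · exact EReal.coe_lt_coe_iff.2 (ht₀T.trans hTT')
  · exact hwc.mono fun t ht =>
      ⟨ht.1, (EReal.coe_lt_coe_iff.1 ht.2).trans_le (min_le_right _ _)⟩
  · intro s
    rw [hwx _ (by linarith [s.2.2]), h.initial]
  · exact le_top.trans (hi₁ ▸ le_iSup te' (i₀ + 1))
  · intro i t h1 h2 h3
    rcases lt_or_ge t T with htT | htT
    · have htT' : (t : EReal) < T := EReal.coe_lt_coe_iff.2 htT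
      have hi := (hres i).1 (h1.trans_lt htT')
      obtain ⟨p, hp, -⟩ := hte'.exists_real (h1.trans_lt (EReal.coe_lt_top t)).ne
      have hpt : p ≤ t := EReal.coe_le_coe_iff.1 (hp ▸ h1)
      have hi1 : (t : EReal) < te (i + 1) := by
        rcases lt_or_ge (te' (i + 1)) T with h4 | h4
        · rwa [(hres (i + 1)).1 h4]
        · rw [(hres (i + 1)).2 h4]
          exact EReal.coe_lt_top t
      have hode := h.ode i t (hi ▸ h1) hi1 htT'
      rw [hi, hp, EReal.toReal_coe] at hode
      rw [hp, EReal.toReal_coe, hwx p (hpt.trans_lt htT),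
        histSeg_congr (y := x) fun s hs => hwx s (hs.2.trans_lt htT)]
      refine hode.congr_of_eventuallyEq ?_ (hwx t htT)
      filter_upwards [mem_nhdsWithin_of_mem_nhds (Iio_mem_nhds htT)] with s hs using hwx s hs
    · have hqt : (q : EReal) ≤ t := EReal.coe_le_coe_iff.2 (hqT.trans htT)
      have hii : i = i₀ := by
        rcases lt_trichotomy i i₀ with hlt | heq | hgt
        · exact absurd (h2.trans_le (hte'.monotone hlt)) (by rw [hi₀]; exact hqt.not_gt)
        · exact heq
        · have : (⊤ : EReal) ≤ te' i := hi₁ ▸ hte'.monotone hgt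
          exact absurd (this.trans h1) (EReal.coe_lt_top t).not_ge
      rw [hii, hi₀, EReal.toReal_coe, hwz q hqT,
        histSeg_congr (y := y) fun s hs => hwy s (by linarith [hs.1])]
      have hode := hy.ode t
        ⟨htT, (EReal.coe_lt_coe_iff.1 h3).trans_le (min_le_right _ _)⟩
      refine hode.congr (fun s hs => hwy s ?_) (hwy t (by linarith))
      linarith [mem_Ici.1 hs]

/-- The pair `q` of an end time and a function continues the pair `p`. -/
def Continues {n : ℕ} (s : ℝ) (p q : EReal × (ℝ → Euc n)) : Prop :=
  p.1 ≤ q.1 ∧ ∀ t : ℝ, s ≤ t → (t : EReal) < p.1 → q.2 t = p.2 t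

lemma Continues.refl {s : ℝ} (p : EReal × (ℝ → Euc n)) : Continues s p p :=
  ⟨le_rfl, fun _ _ _ => rfl⟩

lemma Continues.trans {s : ℝ} {p q r : EReal × (ℝ → Euc n)} (h : Continues s p q)
    (h' : Continues s q r) : Continues s p r :=
  ⟨h.1.trans h'.1, fun t h1 h2 => (h'.2 t h1 (h2.trans_le h.1)).trans (h.2 t h1 h2)⟩

/-- The union of a chain of trajectories is a trajectory. -/
lemma exists_trajectory_of_chain (hτ : 0 < τ) {c : Set (EReal × (ℝ → Euc n))}
    (hc : IsChain (Continues (t₀ - τ)) c) (hne : c.Nonempty)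
    (htr : ∀ p ∈ c, ∃ te, IsTrajectory f k χ α₁ σ a b t₀ φ p.1 p.2 te) :
    ∃ q : EReal × (ℝ → Euc n), (∃ te, IsTrajectory f k χ α₁ σ a b t₀ φ q.1 q.2 te) ∧
      ∀ p ∈ c, Continues (t₀ - τ) p q := by
  classical
  set T : EReal := sSup (Prod.fst '' c) with hT
  have hleT : ∀ p ∈ c, p.1 ≤ T := fun p hp => le_sSup ⟨p, hp, rfl⟩
  have hex : ∀ {t : EReal}, t < T → ∃ p ∈ c, t < p.1 := by
    intro t ht
    obtain ⟨_, ⟨p, hp, rfl⟩, htp⟩ := lt_sSup_iff.1 ht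
    exact ⟨p, hp, htp⟩
  set x : ℝ → Euc n := fun t =>
    if H : ∃ p ∈ c, (t : EReal) < p.1 then H.choose.2 t else 0 with hx
  have hxp : ∀ p ∈ c, ∀ t : ℝ, t₀ - τ ≤ t → (t : EReal) < p.1 → x t = p.2 t := by
    intro p hp t h1 h2
    have H : ∃ p ∈ c, (t : EReal) < p.1 := ⟨p, hp, h2⟩
    obtain ⟨hq, htq⟩ := H.choose_spec
    simp only [hx, dif_pos H]
    rcases eq_or_ne H.choose p with heq | hnepq
    · rw [heq]
    · rcases hc hq hp hnepq with h3 | h3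
      · exact (h3.2 t h1 htq).symm
      · exact h3.2 t h1 h2
  obtain ⟨te, hte⟩ := exists_isEventSeq χ α₁ σ a b t₀ T x
  choose! te' hte' using htr
  have hres := fun p (hp : p ∈ c) => hte.restrict (hte' p hp).isEventSeq (hleT p hp) (hte' p hp).lt
    fun t h1 h2 => hxp p hp t (by linarith) h2
  have hopen : ∀ {t : ℝ} {S : EReal}, (t : EReal) < S → {s : ℝ | (s : EReal) < S} ∈ 𝓝 t :=
    fun {t S} ht => (isOpen_Iio.preimage continuous_coe_real_ereal).mem_nhds ht
  obtain ⟨p₀, hp₀⟩ := hne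
  refine ⟨(T, x), ⟨te, ?_, ?_, ?_, hte.zero, hte.succ, ?_, ?_⟩,
    fun p hp => ⟨hleT p hp, hxp p hp⟩⟩
  · exact (hte' p₀ hp₀).lt.trans_le (hleT p₀ hp₀)
  · rintro t ⟨h1, h2⟩
    obtain ⟨p, hp, htp⟩ := hex h2
    have h3 : ContinuousWithinAt p.2 {s : ℝ | t₀ - τ ≤ s ∧ (s : EReal) < T} t := by
      refine ((hte' p hp).continuousOn t ⟨h1, htp⟩).mono_of_mem_nhdsWithin ?_
      filter_upwards [self_mem_nhdsWithin, mem_nhdsWithin_of_mem_nhds (hopen htp)]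
        with s hs hsp using ⟨hs.1, hsp⟩
    refine h3.congr_of_eventuallyEq ?_ (hxp p hp t h1 htp)
    filter_upwards [self_mem_nhdsWithin, mem_nhdsWithin_of_mem_nhds (hopen htp)]
      with s hs hsp using hxp p hp s hs.1 hsp
  · intro s
    have hs : ((t₀ + s.1 : ℝ) : EReal) ≤ t₀ := EReal.coe_le_coe_iff.2 (by linarith [s.2.2])
    exact (hxp p₀ hp₀ _ (by linarith [s.2.1]) (hs.trans_lt (hte' p₀ hp₀).lt)).trans
      ((hte' p₀ hp₀).initial s)
  · refine le_of_forall_lt fun t ht => ?_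
    obtain ⟨p, hp, htp⟩ := hex ht
    obtain ⟨i, hi⟩ := lt_iSup_iff.1 (htp.trans_le (hte' p hp).covers)
    refine lt_iSup_iff.2 ⟨i, ?_⟩
    rcases lt_or_ge (te i) p.1 with h4 | h4
    · rwa [← (hres p hp i).1 h4]
    · exact htp.trans_le h4
  · intro i t h1 h2 h3
    obtain ⟨p, hp, htp⟩ := hex h3
    have hi := (hres p hp i).1 (h1.trans_lt htp)
    obtain ⟨r, hr, hr0⟩ := hte.exists_real (h1.trans_lt (EReal.coe_lt_top t)).ne
    have hrt : r ≤ t := EReal.coe_le_coe_iff.1 (hr ▸ h1)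
    have hi1 : (t : EReal) < te' p (i + 1) := by
      rcases lt_or_ge (te (i + 1)) p.1 with h4 | h4
      · rwa [(hres p hp (i + 1)).1 h4]
      · rw [(hres p hp (i + 1)).2 h4]
        exact EReal.coe_lt_top t
    have hode := (hte' p hp).ode i t (hi ▸ h1) hi1 htp
    rw [hi, hr, EReal.toReal_coe] at hode
    have hle : ∀ {s : ℝ}, s ≤ t → (s : EReal) < p.1 := fun hs =>
      (EReal.coe_le_coe_iff.2 hs).trans_lt htp
    rw [hr, EReal.toReal_coe]
    change HasDerivWithinAt x (f t (histSeg τ x t) (k (x r))) (Ici t) t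
    rw [hxp p hp r (by linarith) (hle hrt),
      histSeg_congr (y := p.2) fun s hs => hxp p hp s (by linarith [hs.1]) (hle hs.2)]
    refine hode.congr_of_eventuallyEq ?_ (hxp p hp t (by linarith) htp)
    filter_upwards [self_mem_nhdsWithin, mem_nhdsWithin_of_mem_nhds (hopen htp)]
      with s hs hsp using hxp p hp s (by linarith [mem_Ici.1 hs]) hsp

/-- If every trajectory on a bounded interval can be continued a little, then every trajectory can
be continued to `[t₀, ∞)`. -/
lemma IsTrajectory.exists_global_continuation {T : EReal} {x : ℝ → Euc n} {te : ℕ → EReal}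
    (h : IsTrajectory f k χ α₁ σ a b t₀ φ T x te) (hτ : 0 < τ)
    (hstep : ∀ (S : ℝ) (y : ℝ → Euc n) (te : ℕ → EReal),
      IsTrajectory f k χ α₁ σ a b t₀ φ S y te → ∃ S' > S, ∃ (y' : ℝ → Euc n) (te' : ℕ → EReal),
        IsTrajectory f k χ α₁ σ a b t₀ φ (S' : ℝ) y' te' ∧ ∀ t, t < S → y' t = y t) :
    ∃ x' te', IsTrajectory f k χ α₁ σ a b t₀ φ ⊤ x' te' ∧
      ∀ t : ℝ, t₀ - τ ≤ t → (t : EReal) < T → x' t = x t := by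
  let P := {q : EReal × (ℝ → Euc n) //
    (∃ te, IsTrajectory f k χ α₁ σ a b t₀ φ q.1 q.2 te) ∧ Continues (t₀ - τ) (T, x) q}
  obtain ⟨⟨⟨S, y⟩, ⟨te', hy⟩, hcont⟩, hmax⟩ :=
    exists_maximal_of_chains_bounded (α := P) (r := fun p q => Continues (t₀ - τ) p.1 q.1)
      (fun c hc => by
        rcases c.eq_empty_or_nonempty with rfl | ⟨p₀, hp₀⟩
        · exact ⟨⟨(T, x), ⟨te, h⟩, Continues.refl _⟩, fun _ ha => absurd ha (notMem_empty _)⟩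
        · obtain ⟨q, hq, hcq⟩ := exists_trajectory_of_chain (f := f) (k := k) (χ := χ) (α₁ := α₁)
            (σ := σ) (a := a) (b := b) (φ := φ) hτ (c := Subtype.val '' c)
            (by
              rintro _ ⟨p, hp, rfl⟩ _ ⟨q, hq, rfl⟩ hpq
              exact hc hp hq fun heq => hpq (congrArg Subtype.val heq))
            ⟨p₀.1, p₀, hp₀, rfl⟩ (by rintro _ ⟨p, -, rfl⟩; exact p.2.1)
          exact ⟨⟨q, hq, p₀.2.2.trans (hcq _ ⟨p₀, hp₀, rfl⟩)⟩, fun p hp => hcq _ ⟨p, hp, rfl⟩⟩)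
      (fun h1 h2 => h1.trans h2)
  induction S using EReal.rec with
  | bot => exact absurd hy.lt not_lt_bot
  | top => exact ⟨y, te', hy, hcont.2⟩
  | coe S =>
    obtain ⟨S', hS', y', te'', hy', hyy'⟩ := hstep S y te' hy
    have h1 : Continues (t₀ - τ) ((S : EReal), y) ((S' : EReal), y') :=
      ⟨EReal.coe_le_coe_iff.2 hS'.le, fun t _ ht => hyy' t (EReal.coe_lt_coe_iff.1 ht)⟩
    have h2 := (hmax ⟨((S' : EReal), y'), ⟨te'', hy'⟩, hcont.trans h1⟩ h1).1
    exact absurd (EReal.coe_le_coe_iff.1 h2) hS'.not_ge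

end Continuation

/-! ### Stability and attractivity -/

section Stability

variable {τ : ℝ} {n m : ℕ} {f : ℝ → Hist τ n → Euc m → Euc n} {k : Euc n → Euc m}
  {V₁ : ℝ → Euc n → ℝ} {V₂ : ℝ → Hist τ n → ℝ} {α₁ α₂ α₃ χ : ℝ → ℝ} {μ : ℝ}
  {σ a b : ℝ}

/-- Small initial data give small trajectories on a time interval of given length: whatever samples
are held, `‖ẋ(t)‖ ≤ D sup_{s ≤ t} ‖x(s)‖`, so that `‖x(t)‖` grows at most like `e^{D(t-t₀)}`. -/
lemma exists_small_on_interval (hτ : 0 < τ) (hf0 : ∀ t, 0 ≤ t → f t 0 0 = 0) (hk0 : k 0 = 0)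
    (hk : LocallyLipschitz k) (hχ : ClassK χ) (hα₁ : ClassK α₁) (hσ : 0 ≤ σ) (ha : 0 < a)
    {I : Set ℝ} (hf : LipschitzOnBounded f I) {η T₁ : ℝ} (hη : 0 < η) :
    ∃ δ > 0, ∀ t₀, 0 ≤ t₀ → Icc t₀ (t₀ + T₁) ⊆ I → ∀ φ : Hist τ n, ‖φ‖ < δ →
      ∀ (T : EReal) (x : ℝ → Euc n) (te : ℕ → EReal), IsTrajectory f k χ α₁ σ a b t₀ φ T x te →
      ∀ t : ℝ, t₀ ≤ t → t ≤ t₀ + T₁ → (t : EReal) < T → ‖x t‖ ≤ η := by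
  obtain ⟨K, U, hU, hKU⟩ := hk 0
  obtain ⟨ρ₀, hρ₀, hball⟩ := Metric.mem_nhds_iff.1 hU
  set ρ := min η (ρ₀ / 2) with hρ
  have hρpos : 0 < ρ := lt_min hη (by linarith)
  have hkρ : ∀ v : Euc n, ‖v‖ ≤ ρ → ‖k v‖ ≤ K * ‖v‖ := by
    intro v hv
    have hvU : v ∈ U := hball (mem_ball_zero_iff.2 (by linarith [min_le_right η (ρ₀ / 2)]))
    have := hKU.norm_sub_le hvU (mem_of_mem_nhds hU)
    rwa [hk0, sub_zero, sub_zero] at this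
  have hK0 : (0 : ℝ) ≤ K := K.2
  set R := ρ * (1 + K) with hR
  obtain ⟨L, hL⟩ := hf R
  set D := |L| * (1 + K) with hD
  have hD0 : 0 ≤ D := by positivity
  -- With this `δ` the exponential bound `δ e^{D(t-t₀)}` reaches `ρ` only at `t₀ + T₁`.
  set δ := ρ * Real.exp (-(D * T₁)) with hδ
  have hδ0 : 0 < δ := by positivity
  refine ⟨δ, hδ0, fun t₀ ht₀ hI φ hφ T x te h t₁ h01 h11 h1T => ?_⟩
  set B : ℝ → ℝ := fun t => δ * Real.exp (D * (t - t₀)) with hB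
  have hBmono : Monotone B := fun s t hst =>
    mul_le_mul_of_nonneg_left
      (Real.exp_le_exp.2 (mul_le_mul_of_nonneg_left (by linarith) hD0)) hδ0.le
  have hBt₀ : B t₀ = δ := by simp [hB]
  have hBρ : ∀ t ≤ t₀ + T₁, B t ≤ ρ := by
    intro t ht
    refine (hBmono ht).trans_eq ?_
    simp only [hB, hδ, add_sub_cancel_left, mul_assoc, ← Real.exp_add, neg_add_cancel,
      Real.exp_zero, mul_one]
  have hxc : ContinuousOn x (Icc t₀ t₁) := h.continuousOn_Icc (by linarith) h1T
  suffices hlt : ‖x t₁‖ < B t₁ from hlt.le.trans ((hBρ t₁ h11).trans (min_le_left _ _))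
  by_contra! hge
  -- `s` is the first time at which the bound fails.
  have hclosed : IsClosed {t ∈ Icc t₀ t₁ | B t ≤ ‖x t‖} :=
    isClosed_Icc.isClosed_le (by fun_prop) hxc.norm
  have hcompact : IsCompact {t ∈ Icc t₀ t₁ | B t ≤ ‖x t‖} :=
    isCompact_Icc.of_isClosed_subset hclosed fun _ ht => ht.1
  set s := sInf {t ∈ Icc t₀ t₁ | B t ≤ ‖x t‖} with hs
  obtain ⟨⟨hs0, hs1⟩, hsB⟩ : s ∈ {t ∈ Icc t₀ t₁ | B t ≤ ‖x t‖} :=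
    hcompact.sInf_mem ⟨t₁, ⟨h01, le_rfl⟩, hge⟩
  have hbefore : ∀ t, t₀ - τ ≤ t → t < s → ∀ u, t ≤ u → t₀ ≤ u → ‖x t‖ ≤ B u := by
    intro t ht hts u htu hu
    rcases le_total t t₀ with h0 | h0
    · exact (norm_le_of_initial h.initial ⟨ht, h0⟩).trans
        (hφ.le.trans (hBt₀ ▸ hBmono hu))
    · have : ‖x t‖ < B t := by
        by_contra! hcon
        exact absurd (csInf_le hcompact.bddBelow ⟨⟨h0, hts.le.trans hs1⟩, hcon⟩) hts.not_ge
      exact this.le.trans (hBmono htu)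
  choose! r hr hgap l hl hsol using fun (u : ℝ) (h1 : t₀ ≤ u ∧ (u : EReal) < T) =>
    h.exists_held hτ hχ hα₁ hσ ha h1.1 h1.2
  have hcontra : ‖x s‖ ≤ B s - (δ - ‖φ‖) := by
    refine image_norm_le_of_norm_deriv_right_le_deriv_boundary
      (f' := fun u => f u (histSeg τ x u) (k (x (r u)))) (B := fun u => B u - (δ - ‖φ‖))
      (B' := fun u => δ * (Real.exp (D * (u - t₀)) * (D * 1)))
      (hxc.mono (Icc_subset_Icc le_rfl hs1)) (fun u hu => ?_) ?_ (fun u => ?_) (fun u hu => ?_)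
      (right_mem_Icc.2 hs0)
    · have huT : (u : EReal) < T :=
        (EReal.coe_lt_coe_iff.2 (hu.2.trans_le hs1)).trans h1T
      exact (hsol u ⟨hu.1, huT⟩).ode u ⟨le_rfl, by linarith [hl u ⟨hu.1, huT⟩]⟩
    · rw [hBt₀, sub_sub_cancel]
      exact norm_le_of_initial h.initial ⟨by linarith, le_rfl⟩
    · exact (((((hasDerivAt_id u).sub_const t₀).const_mul D).exp.const_mul δ)).sub_const _
    · have huT : (u : EReal) < T :=
        (EReal.coe_lt_coe_iff.2 (hu.2.trans_le hs1)).trans h1T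
      have hu1 : u ≤ t₀ + T₁ := hu.2.le.trans (hs1.trans h11)
      have hru := hr u ⟨hu.1, huT⟩
      have hBu : B u ≤ ρ := hBρ u hu1
      have hBu0 : 0 ≤ B u := by positivity
      have h1 : ‖histSeg τ x u‖ ≤ B u :=
        norm_histSeg_le (h.continuousOn_Icc (by linarith [hu.1]) huT) hBu0 fun q hq =>
          hbefore q (by linarith [hq.1, hu.1]) (hq.2.trans_lt hu.2) u hq.2 hu.1
      have h2 : ‖x (r u)‖ ≤ B u :=
        hbefore (r u) (by linarith [hru.1]) (hru.2.trans_lt hu.2) u hru.2 hu.1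
      have h3 : ‖k (x (r u))‖ ≤ K * B u :=
        (hkρ _ (h2.trans hBu)).trans (mul_le_mul_of_nonneg_left h2 hK0)
      have h4 : K * B u ≤ K * ρ := mul_le_mul_of_nonneg_left hBu hK0
      have h5 := norm_le_of_lipschitz (f := f) (R := R) (hf0 u (ht₀.trans hu.1)) (by positivity)
        (hL u (hI ⟨hu.1, hu1⟩)) (ψ := histSeg τ x u) (u := k (x (r u)))
        (by rw [hR]; nlinarith) (by rw [hR]; nlinarith)
      have h6 : L * (‖histSeg τ x u‖ + ‖k (x (r u))‖) ≤ |L| * (B u + K * B u) :=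
        mul_le_mul (le_abs_self L) (add_le_add h1 h3) (by positivity) (abs_nonneg L)
      refine h5.trans (h6.trans_eq ?_)
      simp only [hB, hD]
      ring
  linarith

lemma tendsto_threshold (hχ : ClassK χ) (hb : 0 < b) (ha : 0 < a) (c : ℝ) :
    Tendsto (fun t => χ (a * Real.exp (-b * t)) / c) atTop (𝓝 0) := by
  have h1 : Tendsto (fun t => a * Real.exp (-b * t)) atTop (𝓝 0) := by
    have h2 : Tendsto (fun t => -b * t) atTop atBot :=
      tendsto_id.const_mul_atTop_of_neg (neg_lt_zero.2 hb)
    simpa using (Real.tendsto_exp_atBot.comp h2).const_mul a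
  have h3 : Tendsto (fun t => a * Real.exp (-b * t)) atTop (𝓝[Ici 0] 0) :=
    tendsto_nhdsWithin_iff.2 ⟨h1, Eventually.of_forall fun t => mem_Ici.2 (by positivity)⟩
  have h4 := (hχ.continuousOn 0 self_mem_Ici).tendsto.comp h3
  rw [hχ.zero] at h4
  simpa using h4.div_const c

/-- A trajectory that stays very small until the triggering threshold has become small stays small
forever. -/
lemma exists_small_of_small_on_interval {hτ : 0 < τ}
    (hV : LyapunovConditions hτ f k V₁ V₂ α₁ α₂ α₃ χ μ) (hV₁ : ClassV0 V₁) (hV₂ : ClassV0Star V₂)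
    (hα₁ : ClassK α₁) (hα₂ : ClassK α₂) (hα₃ : ClassK α₃) (hχ : ClassK χ) (hσ : 0 ≤ σ)
    (hσμ : σ < μ) (ha : 0 < a) (hb : 0 < b) {ε : ℝ} (hε : 0 < ε) :
    ∃ η > 0, ∃ T₁ : ℝ, ∀ t₀, 0 ≤ t₀ → ∀ (φ : Hist τ n) (T : EReal) (x : ℝ → Euc n)
      (te : ℕ → EReal), IsTrajectory f k χ α₁ σ a b t₀ φ T x te → ‖φ‖ ≤ η →
      (∀ t : ℝ, t₀ ≤ t → t ≤ t₀ + T₁ → (t : EReal) < T → ‖x t‖ ≤ η) →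
      ∀ t : ℝ, t₀ ≤ t → (t : EReal) < T → ‖x t‖ < ε := by
  have hα₁ε := hα₁.pos hε
  obtain ⟨T₁, hT₁, hT₁0⟩ := (((tendsto_threshold hχ hb ha (μ - σ)).eventually
    (gt_mem_nhds (half_pos hα₁ε))).and (eventually_ge_atTop 0)).exists
  have hlim : Tendsto (fun η => α₂ η + α₃ η) (𝓝[>] 0) (𝓝 0) := by
    have h1 := (hα₂.continuousOn 0 self_mem_Ici).tendsto.add
      (hα₃.continuousOn 0 self_mem_Ici).tendsto
    rw [hα₂.zero, hα₃.zero, add_zero] at h1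
    exact h1.mono_left (nhdsWithin_mono _ Ioi_subset_Ici_self)
  obtain ⟨η, ⟨hη, hηε⟩, hη0⟩ := (((hlim.eventually (gt_mem_nhds (half_pos hα₁ε))).and
    (mem_nhdsWithin_of_mem_nhds (Iio_mem_nhds hε))).and self_mem_nhdsWithin).exists
  refine ⟨η, hη0, T₁, fun t₀ ht₀ φ T x te h hφ hsmall t ht htT => ?_⟩
  rcases le_total t (t₀ + T₁) with h1 | h1
  · exact (hsmall t ht h1 htT).trans_lt hηε
  · have h1T : ((t₀ + T₁ : ℝ) : EReal) < T := (EReal.coe_le_coe_iff.2 h1).trans_lt htT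
    have h01 : 0 ≤ t₀ + T₁ := by linarith
    have h2 := hV.lyapunovAlong_le_exp_decay hV₁ hV₂ hχ hα₁ hσ hσμ ha hb ht₀ h
      (s := t₀ + T₁) (by linarith) h1 htT
    have hc1 : ContinuousOn x (Icc (t₀ + T₁ - τ) (t₀ + T₁)) :=
      h.continuousOn_Icc (by linarith) h1T
    have h3 : lyapunovAlong V₁ V₂ x (t₀ + T₁) ≤ α₂ η + α₃ η := by
      refine hV.lyapunovAlong_le hα₂ hα₃ h01 hc1 (le_of_lt hη0) fun s hs => ?_
      rcases le_total s t₀ with hs0 | hs0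
      · exact (norm_le_of_initial h.initial ⟨by linarith [hs.1], hs0⟩).trans hφ
      · exact hsmall s hs0 hs.2 ((EReal.coe_le_coe_iff.2 hs.2).trans_lt h1T)
    have h4 : 0 ≤ lyapunovAlong V₁ V₂ x (t₀ + T₁) :=
      (hα₁.nonneg (norm_nonneg _)).trans (hV.le_lyapunovAlong h01 hc1)
    have h5 : Real.exp (-(μ - σ) * (t - (t₀ + T₁))) ≤ 1 := by
      rw [Real.exp_le_one_iff]
      nlinarith
    have h6 := mul_le_mul_of_nonneg_left h5 h4
    have h7 := hV.le_lyapunovAlong (ht₀.trans ht)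
      (h.continuousOn_Icc (by linarith : t₀ - τ ≤ t - τ) htT)
    rw [add_sub_cancel_left] at h2
    refine (hα₁.strictMonoOn.lt_iff_lt (norm_nonneg _) hε.le).1 ?_
    linarith

/-- Attractivity is uniform in the initial time and on bounded sets of initial data, since the
Lyapunov estimate only involves the elapsed time. -/
lemma exists_uniform_attraction_time {hτ : 0 < τ}
    (hV : LyapunovConditions hτ f k V₁ V₂ α₁ α₂ α₃ χ μ) (hV₁ : ClassV0 V₁) (hV₂ : ClassV0Star V₂)
    (hα₁ : ClassK α₁) (hα₂ : ClassK α₂) (hα₃ : ClassK α₃) (hχ : ClassK χ) (hσ : 0 ≤ σ)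
    (hσμ : σ < μ) (ha : 0 < a) (hb : 0 < b) {r ε : ℝ} (hr : 0 < r) (hε : 0 < ε) :
    ∃ S > 0, ∀ t₀, 0 ≤ t₀ → ∀ φ : Hist τ n, ‖φ‖ ≤ r →
      ∀ (T : EReal) (x : ℝ → Euc n) (te : ℕ → EReal),
      IsTrajectory f k χ α₁ σ a b t₀ φ T x te →
      ∀ t : ℝ, t₀ + S ≤ t → (t : EReal) < T → ‖x t‖ < ε := by
  have hα₁ε := hα₁.pos hε
  have hc : 0 < μ - σ := sub_pos.2 hσμ
  obtain ⟨S₁, hS₁, hS₁0⟩ := (((tendsto_threshold hχ hb ha (μ - σ)).eventually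
    (gt_mem_nhds (half_pos hα₁ε))).and (eventually_gt_atTop 0)).exists
  set M := α₂ r + α₃ r + χ a / (μ - σ) with hM
  have hlim : Tendsto (fun t => M * Real.exp (-(μ - σ) * t)) atTop (𝓝 0) := by
    have h2 : Tendsto (fun t => -(μ - σ) * t) atTop atBot :=
      tendsto_id.const_mul_atTop_of_neg (neg_lt_zero.2 hc)
    simpa using (Real.tendsto_exp_atBot.comp h2).const_mul M
  obtain ⟨S₂, hS₂, hS₂0⟩ := ((hlim.eventually (gt_mem_nhds (half_pos hα₁ε))).and
    (eventually_gt_atTop 0)).exists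
  refine ⟨S₁ + S₂, by linarith, fun t₀ ht₀ φ hφ T x te h t ht htT => ?_⟩
  have h1T : ((t₀ + S₁ : ℝ) : EReal) < T :=
    (EReal.coe_le_coe_iff.2 (by linarith)).trans_lt htT
  have h1 := hV.lyapunovAlong_le_exp_decay hV₁ hV₂ hχ hα₁ hσ hσμ ha hb ht₀ h
    (s := t₀) (t := t₀ + S₁) le_rfl (by linarith) h1T
  have h2 := hV.lyapunovAlong_le_exp_decay hV₁ hV₂ hχ hα₁ hσ hσμ ha hb ht₀ h
    (s := t₀ + S₁) (t := t) (by linarith) (by linarith) htT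
  rw [add_sub_cancel_left] at h2
  rw [sub_self, mul_zero, Real.exp_zero, mul_one] at h1
  have hc0 : ContinuousOn x (Icc (t₀ - τ) t₀) := h.continuousOn_Icc le_rfl h.lt
  have h3 : lyapunovAlong V₁ V₂ x t₀ ≤ α₂ r + α₃ r :=
    hV.lyapunovAlong_le hα₂ hα₃ ht₀ hc0 hr.le fun s hs =>
      (norm_le_of_initial h.initial hs).trans hφ
  have h4 : 0 ≤ lyapunovAlong V₁ V₂ x t₀ :=
    (hα₁.nonneg (norm_nonneg _)).trans (hV.le_lyapunovAlong ht₀ hc0)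
  have h5 : Real.exp (-(μ - σ) * (t₀ + S₁ - t₀)) ≤ 1 := by
    rw [Real.exp_le_one_iff]
    nlinarith
  have h6 := mul_le_mul_of_nonneg_left h5 h4
  have h7 : lyapunovAlong V₁ V₂ x (t₀ + S₁) ≤ M := by
    rw [hM]
    linarith
  have h8 : Real.exp (-(μ - σ) * (t - (t₀ + S₁))) ≤ Real.exp (-(μ - σ) * S₂) :=
    Real.exp_le_exp.2 (by nlinarith)
  have hM0 : 0 ≤ M := by
    have := div_nonneg (hχ.nonneg ha.le) hc.le
    have := hα₂.nonneg hr.le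
    have := hα₃.nonneg hr.le
    rw [hM]
    linarith
  have h9 := mul_le_mul h7 h8 (Real.exp_pos _).le hM0
  have h10 := hV.le_lyapunovAlong (by linarith : (0 : ℝ) ≤ t)
    (h.continuousOn_Icc (by linarith : t₀ - τ ≤ t - τ) htT)
  refine (hα₁.strictMonoOn.lt_iff_lt (norm_nonneg _) hε.le).1 ?_
  linarith

end Stability

end EventTriggered

open EventTriggered in
theorem theorem2 {n m : ℕ} {τ : ℝ} (hτ : 0 < τ)
    (f : ℝ → Hist τ n → Euc m → Euc n) (k : Euc n → Euc m)
    (hf0 : ∀ t, 0 ≤ t → f t 0 0 = 0) (hk0 : k 0 = 0)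
    (hsol : LocallySolvable f)
    (V₁ : ℝ → Euc n → ℝ) (V₂ : ℝ → Hist τ n → ℝ) (α₁ α₂ α₃ χ : ℝ → ℝ) (μ : ℝ)
    (hV₁ : ClassV0 V₁) (hV₂ : ClassV0Star V₂)
    (hα₁ : ClassKInf α₁) (hα₂ : ClassKInf α₂) (hα₃ : ClassKInf α₃) (hχ : ClassK χ) (hμ : 0 < μ)
    (hV : LyapunovConditions hτ f k V₁ V₂ α₁ α₂ α₃ χ μ)
    (σ a b : ℝ) (hσ0 : 0 ≤ σ) (hσ : σ < μ) (ha : 0 < a) (hb : 0 < b)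
    (hα₁inv : ∀ c d : ℝ, 0 < c → c ≤ d →
      ∃ K, LipschitzOnWith K (Function.invFunOn α₁ (Set.Ici 0)) (Set.Icc c d))
    (hχlip : LocallyLipschitzOn (Set.Ici 0) χ)
    (hklip : LocallyLipschitz k)
    (hflip : ∀ S : ℝ, LipschitzOnBounded f (Set.Icc 0 S)) :
    GloballyAsymptoticallyStable f k χ α₁ σ a b ∧
    NoZeno f k χ α₁ σ a b ∧
    (LipschitzOnBounded f (Set.Ici 0) → UniformlyStableAttractive f k χ α₁ σ a b) := by
  have hspeed : ∀ t₀, 0 ≤ t₀ → ∀ (φ : Hist τ n) (T : ℝ) (x : ℝ → Euc n) (te : ℕ → EReal),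
      IsTrajectory f k χ α₁ σ a b t₀ φ T x te →
      ∃ C > 0, ∀ s t, t₀ ≤ s → s ≤ t → t < T → ‖x t - x s‖ ≤ C * (t - s) := by
    intro t₀ ht₀ φ T x te h
    obtain ⟨R, hR, hxR⟩ := h.exists_norm_le hV hV₁ hV₂ hχ hα₁ hσ0 hσ ha hb ht₀
    exact h.exists_lipschitz hτ hf0 hklip.continuous (hflip T) hχ hα₁.toClassK hσ0 ha ht₀ hR hxR
  have hext : ∀ t₀, 0 ≤ t₀ → ∀ (φ : Hist τ n) (T : EReal) (x : ℝ → Euc n) (te : ℕ → EReal),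
      IsTrajectory f k χ α₁ σ a b t₀ φ T x te →
      ∃ x' te', IsTrajectory f k χ α₁ σ a b t₀ φ ⊤ x' te' ∧
        ∀ t : ℝ, t₀ - τ ≤ t → (t : EReal) < T → x' t = x t := by
    intro t₀ ht₀ φ T x te h
    refine h.exists_global_continuation hτ fun S y te' hy => ?_
    obtain ⟨C, hC, hLip⟩ := hspeed t₀ ht₀ φ S y te' hy
    exact hy.exists_continuation hτ hsol hχ hα₁.toClassK hσ0 ha ht₀ hC hLip
      (hy.exists_event_eq_top hχ hα₁.toClassK hσ0 ha hb hC hLip)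
  have hattr := fun {r ε : ℝ} (hr : 0 < r) (hε : 0 < ε) =>
    exists_uniform_attraction_time hV hV₁ hV₂ hα₁.toClassK hα₂.toClassK hα₃.toClassK hχ hσ0 hσ ha hb
      hr hε
  refine ⟨⟨?_, hext, ?_, ?_⟩, ?_, fun hunif => ⟨?_, fun r hr ε hε => hattr hr hε⟩⟩
  · intro t₀ ht₀ φ
    obtain ⟨T, x, te, h⟩ := exists_local_trajectory (k := k) (b := b) hτ hsol hχ hα₁.toClassK hσ0 ha
      ht₀ φ
    obtain ⟨x', te', h', -⟩ := hext t₀ ht₀ φ T x te h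
    exact ⟨x', te', h'⟩
  · intro t₀ ht₀ ε hε
    obtain ⟨η, hη, T₁, hsmall⟩ := exists_small_of_small_on_interval hV hV₁ hV₂ hα₁.toClassK
      hα₂.toClassK hα₃.toClassK hχ hσ0 hσ ha hb hε
    obtain ⟨δ, hδ, hδs⟩ := exists_small_on_interval (b := b) (T₁ := T₁) hτ hf0 hk0 hklip hχ
      hα₁.toClassK hσ0 ha (hflip (t₀ + T₁)) hη
    refine ⟨min δ η, lt_min hδ hη, fun φ hφ T x te h => ?_⟩
    exact hsmall t₀ ht₀ φ T x te h (hφ.le.trans (min_le_right _ _))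
      (hδs t₀ ht₀ (Set.Icc_subset_Icc ht₀ le_rfl) φ (hφ.trans_le (min_le_left _ _)) T x te h)
  · intro t₀ ht₀ φ x te h
    rw [Metric.tendsto_atTop]
    intro ε hε
    obtain ⟨S, -, hS⟩ := hattr (r := ‖φ‖ + 1) (by positivity) hε
    refine ⟨t₀ + S, fun t ht => ?_⟩
    rw [dist_zero_right, norm_norm]
    exact hS t₀ ht₀ φ (by linarith) ⊤ x te h t ht (EReal.coe_lt_top t)
  · intro t₀ ht₀ φ T x te h S
    have hmono := h.isEventSeq.monotone
    obtain ⟨N, hN⟩ : ∃ N, (S : EReal) < te N := by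
      by_contra! hle
      have hTS : T ≤ S := h.covers.trans (iSup_le hle)
      lift T to ℝ using ⟨(hTS.trans_lt (EReal.coe_lt_top S)).ne,
        ((EReal.bot_lt_coe t₀).trans h.lt).ne'⟩
      obtain ⟨C, hC, hLip⟩ := hspeed t₀ ht₀ φ T x te h
      obtain ⟨N, hN⟩ := h.exists_event_eq_top hχ hα₁.toClassK hσ0 ha hb hC hLip
      exact absurd (hN ▸ hle N) (EReal.coe_lt_top S).not_ge
    exact (Set.finite_Iio N).subset fun i hi => hmono.reflect_lt (lt_of_le_of_lt hi hN)
  · intro ε hε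
    obtain ⟨η, hη, T₁, hsmall⟩ := exists_small_of_small_on_interval hV hV₁ hV₂ hα₁.toClassK
      hα₂.toClassK hα₃.toClassK hχ hσ0 hσ ha hb hε
    obtain ⟨δ, hδ, hδs⟩ := exists_small_on_interval (b := b) (T₁ := T₁) hτ hf0 hk0 hklip hχ
      hα₁.toClassK hσ0 ha hunif hη
    refine ⟨min δ η, lt_min hδ hη, fun t₀ ht₀ φ hφ T x te h => ?_⟩
    exact hsmall t₀ ht₀ φ T x te h (hφ.le.trans (min_le_right _ _))
      (hδs t₀ ht₀ (fun t ht => ht₀.trans ht.1) φ (hφ.trans_le (min_le_left _ _)) T x te h)
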